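/- **Theorem 3.1.** Let $\lambda\in C^1((0,+\infty);(0,+\infty))$, let $\rho_s>0$ be a constant, let $\rho_0\in C^1([0,1];(0,+\infty))$, and let $b\in C^1([0,+\infty))$ be a bounded function such that $$\rho_s\exp(b(0))=\rho_0(0),\qquad \dot b(0)=-\lambda\left(\int_0^1\rho_0(x)\,dx\right)\frac{\rho_0'(0)}{\rho_0(0)} .$$ Then there exists a unique function $\rho\in C^1([0,+\infty)\times[0,1];(0,+\infty))$ such that, with $$W(t)=\int_0^1\rho(t,x)\,dx,\qquad u(t)=\rho_s\,\lambda(W(t))\exp(b(t))\qquad\text{for } t\ge 0,$$ the following equations hold: $$\frac{\partial\rho}{\partial t}(t,x)+\lambda(W(t))\frac{\partial\rho}{\partial x}(t,x)=0\quad\text{for }(t,x)\in[0,+\infty)\times[0,1],$$ $$\rho(t,0)\,\lambda(W(t))=u(t)\quad\text{for }t\ge 0,\qquad \rho(0,x)=\rho_0(x)\quad\text{for }x\in(0,1].$$ Furthermore, for all $t\ge0$, $p\in(1,+\infty)$ and $\mu>0$, the function $\rho$ satisfies $$\left(\int_0^1\left|\ln\left(\frac{\rho(t,x)}{\rho_s}\right)\right|^p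 dx\right)^{1/p}\le h(t-r)\left(\int_0^1\left|\ln\left(\frac{\rho_0(x)}{\rho_s}\right)\right|^p dx\right)^{1/p}+\left(\frac{\exp(p\mu r)-1}{p\mu r}\right)^{1/p}\max_{\max(0,t-r)\le s\le t}\bigl(|b(s)|\exp(-\mu(t-s))\bigr)$$ and $$\max_{0\le x\le1}\left|\ln\left(\frac{\rho(t,x)}{\rho_s}\right)\right|\le h(t-r)\max_{0\le x\le1}\left|\ln\left(\frac{\rho_0(x)}{\rho_s}\right)\right|+\exp(\mu r)\max_{\max(0,t-r)\le s\le t}\bigl(|b(s)|\exp(-\mu(t-s))\bigr),$$ where $h(s)=1$ for $s<0$, $h(s)=0$ for $s\ge0$, and, with $$m=\min\left(\min_{0\le x\le1}\rho_0(x),\ \rho_s\exp\Bigl(\inf_{t\ge0}b(t)\Bigr)\right),\qquad M=\max\left(\max_{0\le x\le1}\rho_0(x),\ \rho_s\exp\Bigl(\sup_{t\ge0}b(t)\Bigr)\right),$$ the terminal time $r$ is $$r=\frac{1}{\min\{\lambda(s): m\le s\le M\}} .$$ -/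

import Mathlib

noncomputable section

namespace Manufacturing

/-- The total load `W(t) = ∫₀¹ ρ(t,x) dx` of the production line. -/
def totalLoad (ρ : ℝ → ℝ → ℝ) (t : ℝ) : ℝ :=
  ∫ x in (0 : ℝ)..1, ρ t x

/-- The influx rate `u(t) = ρ_s λ(W(t)) exp(b(t))` prescribed by the feedback law. -/
def feedback (lam : ℝ → ℝ) (ρs : ℝ) (b : ℝ → ℝ) (ρ : ℝ → ℝ → ℝ) (t : ℝ) : ℝ :=
  ρs * lam (totalLoad ρ t) * Real.exp (b t)

/-- `ρ` is a positive `C¹` solution on `[0,∞) × [0,1]` of the closed-loop manufacturing model with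
production speed `lam`, set point `ρs`, disturbance `b` and initial profile `ρ₀`. Only the values
of `ρ` on `[0,∞) × [0,1]` matter; derivatives at boundary points are one-sided. -/
structure IsSolution (lam : ℝ → ℝ) (ρs : ℝ) (b ρ₀ : ℝ → ℝ) (ρ : ℝ → ℝ → ℝ) : Prop where
  /-- `ρ` is of class `C¹` on the closed strip. -/
  contDiffOn : ContDiffOn ℝ 1 (fun z : ℝ × ℝ => ρ z.1 z.2) (Set.Ici 0 ×ˢ Set.Icc 0 1)
  /-- `ρ` takes values in `(0,∞)`. -/
  pos : ∀ t ∈ Set.Ici (0 : ℝ), ∀ x ∈ Set.Icc (0 : ℝ) 1, 0 < ρ t x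
  /-- The transport equation `ρ_t + λ(W(t)) ρ_x = 0`. -/
  pde : ∀ t ∈ Set.Ici (0 : ℝ), ∀ x ∈ Set.Icc (0 : ℝ) 1,
    derivWithin (fun s => ρ s x) (Set.Ici 0) t
      + lam (totalLoad ρ t) * derivWithin (fun y => ρ t y) (Set.Icc 0 1) x = 0
  /-- The influx boundary condition `ρ(t,0) λ(W(t)) = u(t)` under the feedback law. -/
  influx : ∀ t ∈ Set.Ici (0 : ℝ), ρ t 0 * lam (totalLoad ρ t) = feedback lam ρs b ρ t
  /-- The initial condition. -/
  initial : ∀ x ∈ Set.Ioc (0 : ℝ) 1, ρ 0 x = ρ₀ x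

/-- `h(s) = 1` for `s < 0` and `h(s) = 0` for `s ≥ 0`. -/
def h (s : ℝ) : ℝ := if s < 0 then 1 else 0

/-- `min (min_{[0,1]} ρ₀, ρ_s exp (inf_{t ≥ 0} b(t)))`. -/
def densityMin (ρs : ℝ) (b ρ₀ : ℝ → ℝ) : ℝ :=
  min (sInf (ρ₀ '' Set.Icc 0 1)) (ρs * Real.exp (sInf (b '' Set.Ici 0)))

/-- `max (max_{[0,1]} ρ₀, ρ_s exp (sup_{t ≥ 0} b(t)))`. -/
def densityMax (ρs : ℝ) (b ρ₀ : ℝ → ℝ) : ℝ :=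
  max (sSup (ρ₀ '' Set.Icc 0 1)) (ρs * Real.exp (sSup (b '' Set.Ici 0)))

/-- The terminal time `r`: the reciprocal of the minimum of `λ` between the two density bounds. -/
def terminalTime (lam : ℝ → ℝ) (ρs : ℝ) (b ρ₀ : ℝ → ℝ) : ℝ :=
  1 / sInf (lam '' Set.Icc (densityMin ρs b ρ₀) (densityMax ρs b ρ₀))

/-- The logarithmic `L^p` norm `(∫₀¹ |ln (f(x)/ρ_s)|^p dx)^{1/p}`. -/
def logNorm (p ρs : ℝ) (f : ℝ → ℝ) : ℝ :=
  (∫ x in (0 : ℝ)..1, |Real.log (f x / ρs)| ^ p) ^ (1 / p)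

/-- The logarithmic sup norm `max_{0 ≤ x ≤ 1} |ln (f(x)/ρ_s)|`. -/
def logSupNorm (ρs : ℝ) (f : ℝ → ℝ) : ℝ :=
  sSup ((fun x => |Real.log (f x / ρs)|) '' Set.Icc 0 1)

/-- The fading memory maximum `max_{max(0,t-r) ≤ s ≤ t} |b(s)| exp(-μ(t-s))`. -/
def memoryMax (b : ℝ → ℝ) (μ r t : ℝ) : ℝ :=
  sSup ((fun s => |b s| * Real.exp (-μ * (t - s))) '' Set.Icc (max 0 (t - r)) t)

end Manufacturing

end

/-! The density is constant along characteristics, so a solution must have the form `ρ t x = g (Λ t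
- x)`, where `Λ t` is the distance travelled by time `t`. Take the distance `τ` as the independent
variable and let `T` be the inverse of `Λ`. Then the load is the integral of `g` over `[τ - 1, τ]`,
and the nonlocal PDE becomes the delay equation `T' = 1 / lam (∫ g)`, where `g y = ρ₀ (-y)` on `[-1,
0]` and `g y = ρs * exp (b (T y))` for `y ≥ 0`.

The reciprocal speed is first truncated outside `[m, M]`, which makes it bounded and Lipschitz. A
contraction in an exponentially weighted norm then solves the equation globally
(`exists_delay_solution`). Since `g` only takes values of the data, which lie in `[m, M]`, the
truncation is never active. The compatibility conditions make `g` of class `C¹` at `0`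
(`exists_characteristic_flow`).

Uniqueness among all `C¹` solutions is a separate `L²` energy estimate with Grönwall's inequality
(`IsSolution.eq`).

For the estimates, a point `x ≤ Λ t` carries the value `|b s|` of its entry time `s`. As the speed
is at least `1 / r`, `t - s ≤ r * x`, so this value is at most the memory maximum times `exp (μ * r
* x)`. Points `x > Λ t` carry translated initial data, and there are none once `t ≥ r`. -/

/-! ### Extension and gluing of `C¹` functions -/

/-- A function of class `C¹` on an interval that is a continuous retract of the line extends to a
function of class `C¹` on the line. -/
theorem exists_contDiff_extension {s : Set ℝ} (hs : Convex ℝ s) (hu : UniqueDiffOn ℝ s)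
    {π : ℝ → ℝ} (hπ : Continuous π) (hπs : ∀ x, π x ∈ s) (hπid : ∀ x ∈ s, π x = x)
    {f : ℝ → ℝ} (hf : ContDiffOn ℝ 1 f s) :
    ∃ F : ℝ → ℝ, ContDiff ℝ 1 F ∧ (∀ x ∈ s, F x = f x) ∧
      ∀ x ∈ s, deriv F x = derivWithin f s x := by
  have hd : Continuous fun y => derivWithin f s (π y) :=
    (hf.continuousOn_derivWithin hu le_rfl).comp_continuous hπ hπs
  set a := π 0 with ha
  have has : a ∈ s := hπs 0
  -- The retraction makes the integrand continuous on the whole line. On `s` the difference `F - f`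
  -- has zero derivative and vanishes at `a`.
  set F : ℝ → ℝ := fun x => f a + ∫ y in a..x, derivWithin f s (π y) with hF
  have hFd : ∀ x, HasDerivAt F (derivWithin f s (π x)) x := fun x =>
    ((hd.integral_hasStrictDerivAt a x).hasDerivAt).const_add (f a)
  have hFd' : deriv F = fun x => derivWithin f s (π x) := funext fun x => (hFd x).deriv
  refine ⟨F, contDiff_one_iff_deriv.2 ⟨fun x => (hFd x).differentiableAt, hFd' ▸ hd⟩, ?_, ?_⟩
  · intro x hx
    have key := hs.norm_image_sub_le_of_norm_hasDerivWithin_le (f := fun y => F y - f y)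
      (f' := fun _ => 0) (C := 0) (x := a) (y := x) (fun y hy => by
        have h1 := (hFd y).hasDerivWithinAt (s := s)
        have h2 := (hf.differentiableOn one_ne_zero y hy).hasDerivWithinAt
        have h3 := h1.sub h2
        rw [hπid y hy, sub_self] at h3
        exact h3) (by simp) has hx
    have hFa : F a = f a := by simp [hF]
    rw [zero_mul] at key
    have := norm_le_zero_iff.1 key
    linarith
  · intro x hx
    rw [(hFd x).deriv, hπid x hx]

theorem exists_contDiff_extension_Icc {a b : ℝ} (hab : a < b) {f : ℝ → ℝ}
    (hf : ContDiffOn ℝ 1 f (Set.Icc a b)) :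
    ∃ F : ℝ → ℝ, ContDiff ℝ 1 F ∧ (∀ x ∈ Set.Icc a b, F x = f x) ∧
      ∀ x ∈ Set.Icc a b, deriv F x = derivWithin f (Set.Icc a b) x :=
  exists_contDiff_extension (convex_Icc a b) (uniqueDiffOn_Icc hab)
    (π := fun x => max a (min b x)) (by fun_prop)
    (fun x => ⟨le_max_left _ _, max_le hab.le (min_le_left _ _)⟩)
    (fun x hx => by simp [hx.1, hx.2]) hf

theorem exists_contDiff_extension_Ici {a : ℝ} {f : ℝ → ℝ}
    (hf : ContDiffOn ℝ 1 f (Set.Ici a)) :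
    ∃ F : ℝ → ℝ, ContDiff ℝ 1 F ∧ (∀ x ∈ Set.Ici a, F x = f x) ∧
      ∀ x ∈ Set.Ici a, deriv F x = derivWithin f (Set.Ici a) x :=
  exists_contDiff_extension (convex_Ici a) (uniqueDiffOn_Ici a)
    (π := fun x => max a x) (by fun_prop) (fun x => Set.mem_Ici.2 (le_max_left _ _))
    (fun x hx => max_eq_right hx) hf

/-- Two `C¹` functions that agree to first order at a point can be glued there. -/
theorem contDiff_one_ite_le {f₁ f₂ : ℝ → ℝ} {a : ℝ} (h₁ : ContDiff ℝ 1 f₁)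
    (h₂ : ContDiff ℝ 1 f₂) (h0 : f₁ a = f₂ a) (h1 : deriv f₁ a = deriv f₂ a) :
    ContDiff ℝ 1 fun y => if y ≤ a then f₁ y else f₂ y := by
  set F : ℝ → ℝ := fun y => if y ≤ a then f₁ y else f₂ y with hF
  have d₁ := fun y => ((h₁.differentiable one_ne_zero) y).hasDerivAt
  have d₂ := fun y => ((h₂.differentiable one_ne_zero) y).hasDerivAt
  have e₁ : ∀ y ∈ Set.Iic a, F y = f₁ y := fun y hy => if_pos hy
  have e₂ : ∀ y ∈ Set.Ici a, F y = f₂ y := by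
    intro y hy
    rcases eq_or_lt_of_le (Set.mem_Ici.1 hy) with rfl | h
    · simp [hF, h0]
    · simp [hF, h.not_ge]
  have hd : ∀ y, HasDerivAt F (if y ≤ a then deriv f₁ y else deriv f₂ y) y := by
    intro y
    rcases lt_trichotomy y a with h | rfl | h
    · rw [if_pos h.le]
      exact (d₁ y).congr_of_eventuallyEq
        (Filter.eventually_of_mem (Iio_mem_nhds h) fun z hz => e₁ z (Set.mem_Iio.1 hz).le)
    · rw [if_pos le_rfl]
      have l := ((d₁ y).hasDerivWithinAt (s := Set.Iic y)).congr e₁ (e₁ y Set.self_mem_Iic)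
      have r := ((d₂ y).hasDerivWithinAt (s := Set.Ici y)).congr e₂ (e₂ y Set.self_mem_Ici)
      rw [← h1] at r
      have := l.union r
      rwa [Set.Iic_union_Ici, hasDerivWithinAt_univ] at this
    · rw [if_neg h.not_ge]
      exact (d₂ y).congr_of_eventuallyEq
        (Filter.eventually_of_mem (Ioi_mem_nhds h) fun z hz => e₂ z (Set.mem_Ioi.1 hz).le)
  refine contDiff_one_iff_deriv.2 ⟨fun y => (hd y).differentiableAt, ?_⟩
  rw [show deriv F = _ from funext fun y => (hd y).deriv]
  exact Continuous.if_le (h₁.continuous_deriv le_rfl) (h₂.continuous_deriv le_rfl)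
    continuous_id continuous_const (by rintro y rfl; exact h1)

/-! ### Contraction in weighted norms -/

/-- Banach's fixed point theorem for real functions in a weighted sup norm. -/
theorem exists_fixedPoint_of_weighted_contraction {X : Type*} [TopologicalSpace X]
    {w : X → ℝ} (hw : Continuous w) (hwpos : ∀ x, 0 < w x) {Φ : (X → ℝ) → X → ℝ} {C : ℝ}
    (hΦ : ∀ T, Continuous T → Continuous (Φ T))
    (hbound : ∀ T, Continuous T → ∀ x, |Φ T x| ≤ C * w x)
    (hcontr : ∀ T₁ T₂, Continuous T₁ → Continuous T₂ → ∀ D, 0 ≤ D →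
      (∀ x, |T₁ x - T₂ x| ≤ D * w x) → ∀ x, |Φ T₁ x - Φ T₂ x| ≤ D / 2 * w x) :
    ∃ T, Continuous T ∧ Φ T = T := by
  have hc : ∀ S : BoundedContinuousFunction X ℝ, Continuous fun x => w x * S x :=
    fun S => hw.mul S.continuous
  -- The substitution `T = w * S` turns the weighted norm into the sup norm on bounded continuous
  -- functions.
  let Ψ : BoundedContinuousFunction X ℝ → BoundedContinuousFunction X ℝ := fun S =>
    BoundedContinuousFunction.ofNormedAddCommGroup (fun x => Φ (fun x => w x * S x) x / w x)
      ((hΦ _ (hc S)).div hw fun x => (hwpos x).ne') C (fun x => by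
        rw [Real.norm_eq_abs, abs_div, abs_of_pos (hwpos x), div_le_iff₀ (hwpos x)]
        exact hbound _ (hc S) x)
  have hΨ : ContractingWith (1 / 2) Ψ := by
    refine ⟨by rw [← NNReal.coe_lt_coe]; norm_num, LipschitzWith.of_dist_le_mul fun S₁ S₂ => ?_⟩
    rw [BoundedContinuousFunction.dist_le (by positivity)]
    intro x
    have := hcontr _ _ (hc S₁) (hc S₂) (dist S₁ S₂) dist_nonneg (fun y => by
      rw [← mul_sub, abs_mul, abs_of_pos (hwpos y), mul_comm, ← Real.dist_eq]
      exact mul_le_mul_of_nonneg_right (S₁.dist_coe_le_dist y) (hwpos y).le) x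
    change dist (Φ (fun x => w x * S₁ x) x / w x) (Φ (fun x => w x * S₂ x) x / w x) ≤ _
    rw [Real.dist_eq, ← sub_div, abs_div, abs_of_pos (hwpos x), div_le_iff₀ (hwpos x)]
    refine this.trans_eq ?_
    push_cast
    ring
  have hfix := hΨ.fixedPoint_isFixedPt
  set S := ContractingWith.fixedPoint Ψ hΨ
  refine ⟨fun x => w x * S x, hc S, funext fun x => ?_⟩
  have : Φ (fun x => w x * S x) x / w x = S x := congrArg (fun R => R x) hfix
  rw [← this, mul_div_cancel₀ _ (hwpos x).ne']

/-- A `C¹` function on the line is Lipschitz on `[0, y]` with a constant continuous in `y`. -/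
theorem exists_continuous_lipschitz_bound {B : ℝ → ℝ} (hB : ContDiff ℝ 1 B) :
    ∃ l : ℝ → ℝ, Continuous l ∧ (∀ y, 0 ≤ l y) ∧
      ∀ y, ∀ u ∈ Set.Icc 0 y, ∀ v ∈ Set.Icc 0 y, |B u - B v| ≤ l y * |u - v| := by
  have hd := hB.continuous_deriv le_rfl
  -- Rescaling `[0, y]` to the fixed compact set `[0, 1]` makes the supremum continuous in `y`.
  have hcont : Continuous fun y : ℝ => sSup ((fun s : ℝ => |deriv B (s * y)|) '' Set.Icc 0 1) :=
    IsCompact.continuous_sSup isCompact_Icc (f := fun y s : ℝ => |deriv B (s * y)|)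
      (by simp only [Function.HasUncurry.uncurry, id]; fun_prop)
  have hbdd : ∀ y, ∀ s ∈ Set.Icc (0 : ℝ) 1,
      |deriv B (s * y)| ≤ sSup ((fun s : ℝ => |deriv B (s * y)|) '' Set.Icc 0 1) := fun y s hs =>
    le_csSup (isCompact_Icc.bddAbove_image (by fun_prop)) (Set.mem_image_of_mem _ hs)
  refine ⟨_, hcont, fun y => (abs_nonneg _).trans (hbdd y 0 (by simp)), fun y u hu v hv => ?_⟩
  refine (convex_Icc 0 y).norm_image_sub_le_of_norm_deriv_le
    (fun x _ => (hB.differentiable one_ne_zero) x) (fun x hx => ?_) hv hu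
  rcases eq_or_lt_of_le (hx.1.trans hx.2) with h0 | hy
  · have := hbdd y 0 (by simp)
    rw [zero_mul] at this
    rwa [le_antisymm (hx.2.trans h0.symm.le) hx.1]
  · have := hbdd y (x / y) ⟨div_nonneg hx.1 hy.le, (div_le_one hy).2 hx.2⟩
    rwa [div_mul_cancel₀ _ hy.ne'] at this

/-- An exponential weight that dominates the primitives of itself and of its product with `κ`. -/
theorem exists_growth_weight {κ : ℝ → ℝ} (hκ : Continuous κ) (hκ0 : ∀ y, 0 ≤ κ y) {c : ℝ}
    (hc : 0 < c) :
    ∃ w : ℝ → ℝ, Continuous w ∧ Monotone w ∧ (∀ τ, 0 < w τ) ∧ (∀ τ, 0 ≤ τ → c * τ ≤ w τ) ∧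
      (∀ τ, 0 ≤ τ → ∫ y in (0 : ℝ)..τ, w y ≤ w τ / c) ∧
      ∀ τ, 0 ≤ τ → ∫ y in (0 : ℝ)..τ, κ y * w y ≤ w τ / c := by
  have hk : Continuous fun y => c * (1 + κ y) := by fun_prop
  -- With `w = exp E`, `w' = c * (1 + κ) * w`, so both `w` and `κ * w` are at most `w' / c`.
  set E : ℝ → ℝ := fun τ => ∫ y in (0 : ℝ)..τ, c * (1 + κ y) with hE
  have hEd : ∀ τ, HasDerivAt E (c * (1 + κ τ)) τ := fun τ =>
    (hk.integral_hasStrictDerivAt 0 τ).hasDerivAt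
  have hEc : Continuous E := continuous_iff_continuousAt.2 fun τ => (hEd τ).continuousAt
  have hwd : ∀ τ, HasDerivAt (fun τ => Real.exp (E τ)) (Real.exp (E τ) * (c * (1 + κ τ))) τ :=
    fun τ => (hEd τ).exp
  have hwc : Continuous fun τ => Real.exp (E τ) := by fun_prop
  have hw0 : Real.exp (E 0) = 1 := by simp [hE]
  have hint : ∀ τ, ∫ y in (0 : ℝ)..τ, Real.exp (E y) * (c * (1 + κ y)) = Real.exp (E τ) - 1 := by
    intro τ
    rw [intervalIntegral.integral_eq_sub_of_hasDerivAt (fun y _ => hwd y)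
      ((hwc.mul hk).intervalIntegrable _ _), hw0]
  have hmono : Monotone fun τ => Real.exp (E τ) := by
    refine monotone_of_deriv_nonneg (fun τ => (hwd τ).differentiableAt) fun τ => ?_
    rw [(hwd τ).deriv]
    have := hκ0 τ
    positivity
  have hle : ∀ f : ℝ → ℝ, Continuous f → (∀ y, f y ≤ 1 + κ y) → ∀ τ, 0 ≤ τ →
      ∫ y in (0 : ℝ)..τ, f y * Real.exp (E y) ≤ Real.exp (E τ) / c := by
    intro f hf hfκ τ hτ
    rw [le_div_iff₀ hc, ← intervalIntegral.integral_mul_const]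
    calc _ ≤ ∫ y in (0 : ℝ)..τ, Real.exp (E y) * (c * (1 + κ y)) := by
          refine intervalIntegral.integral_mono_on hτ
            (Continuous.intervalIntegrable (by fun_prop) _ _)
            ((hwc.mul hk).intervalIntegrable _ _) fun y _ => ?_
          have := mul_le_mul_of_nonneg_left (hfκ y) (mul_pos (Real.exp_pos (E y)) hc).le
          linarith
      _ ≤ _ := by rw [hint]; linarith
  refine ⟨fun τ => Real.exp (E τ), hwc, hmono, fun τ => Real.exp_pos _, fun τ hτ => ?_,
    fun τ hτ => ?_, fun τ hτ => hle κ hκ (fun y => by linarith) τ hτ⟩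
  · have h1 : c * τ ≤ E τ := by
      calc c * τ = ∫ y in (0 : ℝ)..τ, c := by simp [mul_comm]
        _ ≤ _ := intervalIntegral.integral_mono_on hτ (by simp) (hk.intervalIntegrable _ _)
          fun y _ => by nlinarith [hκ0 y]
    linarith [Real.add_one_le_exp (E τ)]
  · simpa using hle (fun _ => 1) continuous_const (fun y => by linarith [hκ0 y]) τ hτ

/-! ### The delay equation for the transit time -/

/-- The flux profile generated by the transit function `T`: the prescribed history `φ` for
nonpositive arguments, continued by `B ∘ T` with `T` truncated to `[0, r y]`. -/
noncomputable def delayProfile (φ B : ℝ → ℝ) (r : ℝ) (T : ℝ → ℝ) (y : ℝ) : ℝ :=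
  if y ≤ 0 then φ y else B (max (min (T y) (r * y)) 0)

theorem continuous_delayProfile {φ B : ℝ → ℝ} (hφ : Continuous φ) (hB : Continuous B)
    (h0 : φ 0 = B 0) (r : ℝ) {T : ℝ → ℝ} (hT : Continuous T) :
    Continuous (delayProfile φ B r T) :=
  Continuous.if_le hφ (by fun_prop) continuous_id continuous_const (by
    rintro y rfl
    simp [h0])

/-- The integral operator of the delay equation `T' = q (∫ y in τ-1..τ, delayProfile φ B r T y)`. -/
noncomputable def delayOperator (q φ B : ℝ → ℝ) (r : ℝ) (T : ℝ → ℝ) (τ : ℝ) : ℝ :=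
  ∫ σ in (0 : ℝ)..τ, q (∫ y in (σ - 1)..σ, delayProfile φ B r T y)

theorem continuous_window_integral {f : ℝ → ℝ} (hf : Continuous f) :
    Continuous fun σ : ℝ => ∫ y in (σ - 1)..σ, f y := by
  have hN : Continuous fun σ : ℝ => ∫ y in (0 : ℝ)..σ, f y :=
    intervalIntegral.continuous_primitive (fun _ _ => hf.intervalIntegrable _ _) 0
  have : (fun σ : ℝ => ∫ y in (σ - 1)..σ, f y) =
      fun σ => (∫ y in (0 : ℝ)..σ, f y) - ∫ y in (0 : ℝ)..(σ - 1), f y := funext fun σ =>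
    (intervalIntegral.integral_interval_sub_left (hf.intervalIntegrable _ _)
      (hf.intervalIntegrable _ _)).symm
  rw [this]
  exact hN.sub (hN.comp (by fun_prop))

/-- Truncation confines the argument of `B` to `[0, r * y]` whatever `T` is, so at each `y` a
Lipschitz constant `l (r * y)` serves all `T`. The weight absorbs the growth of this constant in
`y`, and no restriction to short times is needed. -/
theorem exists_delayOperator_fixedPoint {q φ B : ℝ → ℝ} {r : ℝ} {K : NNReal}
    (hq : LipschitzWith K q) (hqr : ∀ x, |q x| ≤ r) (hφ : Continuous φ) (hB : ContDiff ℝ 1 B)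
    (h0 : φ 0 = B 0) :
    ∃ T : ℝ → ℝ, Continuous T ∧ delayOperator q φ B r T = T := by
  have hr : 0 ≤ r := (abs_nonneg _).trans (hqr 0)
  obtain ⟨l, hl, hl0, hlB⟩ := exists_continuous_lipschitz_bound hB
  set c : ℝ := 1 + 4 * K with hc
  have hK : (0 : ℝ) ≤ K := K.2
  -- Two nested integrations each gain `1 / c`, and the window has two endpoints. Contraction by one
  -- half therefore requires `4 * K ≤ c * c`; the summand `1` gives `c ≥ 1`, used for the growth
  -- bound.
  have hc1 : 1 ≤ c := by linarith
  have hc0 : 0 < c := by linarith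
  obtain ⟨w, hw, hwm, hwp, hwl, hwi, hwk⟩ := exists_growth_weight
    (κ := fun y => l (r * y)) (by fun_prop) (fun y => hl0 _) hc0
  have hprof := fun (T : ℝ → ℝ) (hT : Continuous T) =>
    continuous_delayProfile hφ hB.continuous h0 r hT
  have hpace : ∀ T : ℝ → ℝ, Continuous T →
      Continuous fun σ : ℝ => q (∫ y in (σ - 1)..σ, delayProfile φ B r T y) := fun T hT =>
    hq.continuous.comp (continuous_window_integral (hprof T hT))
  refine exists_fixedPoint_of_weighted_contraction (w := fun τ => w |τ|) (C := r) (by fun_prop)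
    (fun τ => hwp _) (fun T hT => intervalIntegral.continuous_primitive
      (fun _ _ => (hpace T hT).intervalIntegrable _ _) 0) (fun T hT τ => ?_) ?_
  · have h1 := intervalIntegral.norm_integral_le_of_norm_le_const (a := 0) (b := τ)
      (f := fun σ => q (∫ y in (σ - 1)..σ, delayProfile φ B r T y)) (fun σ _ => hqr _)
    rw [sub_zero] at h1
    refine h1.trans (mul_le_mul_of_nonneg_left ?_ hr)
    exact (le_mul_of_one_le_left (abs_nonneg _) hc1).trans (hwl _ (abs_nonneg _))
  · intro T₁ T₂ hT₁ hT₂ D hD hdist τ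
    set f : ℝ → ℝ := fun y => delayProfile φ B r T₁ y - delayProfile φ B r T₂ y with hf
    have hfc : Continuous f := (hprof T₁ hT₁).sub (hprof T₂ hT₂)
    have hfneg : ∀ y ≤ 0, f y = 0 := fun y hy => by simp [hf, delayProfile, hy]
    have hfpos : ∀ y, 0 ≤ y → |f y| ≤ D * (l (r * y) * w y) := by
      intro y hy
      rcases eq_or_lt_of_le hy with rfl | hy
      · rw [hfneg _ le_rfl, abs_zero]
        have := hl0 (r * 0)
        have := hwp 0
        positivity
      have hry : 0 ≤ r * y := by positivity
      simp only [hf, delayProfile, hy.not_ge, if_false]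
      have hmem : ∀ t : ℝ, max (min t (r * y)) 0 ∈ Set.Icc 0 (r * y) := fun t =>
        ⟨le_max_right _ _, max_le (min_le_right _ _) hry⟩
      have hclamp : |max (min (T₁ y) (r * y)) 0 - max (min (T₂ y) (r * y)) 0| ≤ |T₁ y - T₂ y| :=
        by
        refine (abs_max_sub_max_le_abs _ _ _).trans ((abs_min_sub_min_le_max _ _ _ _).trans ?_)
        simp
      refine (hlB _ _ (hmem _) _ (hmem _)).trans ?_
      have h1 := hdist y
      rw [abs_of_pos hy] at h1
      calc _ ≤ l (r * y) * (D * w y) := mul_le_mul_of_nonneg_left (hclamp.trans h1) (hl0 _)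
        _ = _ := by ring
    have hNneg : ∀ σ ≤ 0, ∫ y in (0 : ℝ)..σ, f y = 0 := by
      intro σ hσ
      rw [intervalIntegral.integral_congr (g := fun _ => 0) (fun y hy => ?_)]
      · simp
      · rw [Set.uIcc_of_ge hσ] at hy
        exact hfneg y hy.2
    have hNpos : ∀ σ, 0 ≤ σ → |∫ y in (0 : ℝ)..σ, f y| ≤ D * (w σ / c) := by
      intro σ hσ
      calc _ ≤ ∫ y in (0 : ℝ)..σ, |f y| := intervalIntegral.abs_integral_le_integral_abs hσ
        _ ≤ ∫ y in (0 : ℝ)..σ, D * (l (r * y) * w y) :=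
          intervalIntegral.integral_mono_on hσ (hfc.abs.intervalIntegrable _ _)
            (Continuous.intervalIntegrable (by fun_prop) _ _) fun y hy => hfpos y hy.1
        _ = D * ∫ y in (0 : ℝ)..σ, l (r * y) * w y := intervalIntegral.integral_const_mul _ _
        _ ≤ _ := mul_le_mul_of_nonneg_left (hwk σ hσ) hD
    have hwin : ∀ σ, (∫ y in (σ - 1)..σ, delayProfile φ B r T₁ y) -
        ∫ y in (σ - 1)..σ, delayProfile φ B r T₂ y =
        (∫ y in (0 : ℝ)..σ, f y) - ∫ y in (0 : ℝ)..(σ - 1), f y := by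
      intro σ
      rw [← intervalIntegral.integral_sub ((hprof T₁ hT₁).intervalIntegrable _ _)
        ((hprof T₂ hT₂).intervalIntegrable _ _), intervalIntegral.integral_interval_sub_left
        (hfc.intervalIntegrable _ _) (hfc.intervalIntegrable _ _)]
    have hpd : ∀ σ, |q (∫ y in (σ - 1)..σ, delayProfile φ B r T₁ y) -
        q (∫ y in (σ - 1)..σ, delayProfile φ B r T₂ y)| ≤
        K * |(∫ y in (0 : ℝ)..σ, f y) - ∫ y in (0 : ℝ)..(σ - 1), f y| := by
      intro σ
      rw [← hwin]
      exact hq.dist_le_mul _ _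
    have hdiff : delayOperator q φ B r T₁ τ - delayOperator q φ B r T₂ τ =
        ∫ σ in (0 : ℝ)..τ, (q (∫ y in (σ - 1)..σ, delayProfile φ B r T₁ y) -
          q (∫ y in (σ - 1)..σ, delayProfile φ B r T₂ y)) :=
      (intervalIntegral.integral_sub ((hpace T₁ hT₁).intervalIntegrable _ _)
        ((hpace T₂ hT₂).intervalIntegrable _ _)).symm
    rw [hdiff]
    -- For `τ ≤ 0` only the history `φ` enters, so the operator does not depend on `T` there.
    rcases le_total τ 0 with hτ | hτ
    · rw [intervalIntegral.integral_congr (g := fun _ => 0) (fun σ hσ => ?_)]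
      · simp only [intervalIntegral.integral_zero, abs_zero]
        have := hwp |τ|
        positivity
      · rw [Set.uIcc_of_ge hτ] at hσ
        have := hpd σ
        rw [hNneg σ hσ.2, hNneg (σ - 1) (by linarith [hσ.2]), sub_zero, abs_zero, mul_zero] at this
        exact abs_nonpos_iff.1 this
    · rw [abs_of_nonneg hτ]
      have hN : ∀ σ, 0 ≤ σ → |(∫ y in (0 : ℝ)..σ, f y) - ∫ y in (0 : ℝ)..(σ - 1), f y| ≤
          2 * D / c * w σ := by
        intro σ hσ
        have h1 := hNpos σ hσ
        have h2 : |∫ y in (0 : ℝ)..(σ - 1), f y| ≤ D * (w σ / c) := by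
          rcases le_total (σ - 1) 0 with hs | hs
          · rw [hNneg _ hs, abs_zero]
            have := hwp σ
            positivity
          · refine (hNpos _ hs).trans ?_
            gcongr
            exact hwm (by linarith)
        refine (abs_sub _ _).trans ((add_le_add h1 h2).trans_eq ?_)
        ring
      calc _ ≤ ∫ σ in (0 : ℝ)..τ, |q (∫ y in (σ - 1)..σ, delayProfile φ B r T₁ y) -
            q (∫ y in (σ - 1)..σ, delayProfile φ B r T₂ y)| :=
            intervalIntegral.abs_integral_le_integral_abs hτ
        _ ≤ ∫ σ in (0 : ℝ)..τ, (K * (2 * D / c)) * w σ :=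
          intervalIntegral.integral_mono_on hτ
            (((hpace T₁ hT₁).sub (hpace T₂ hT₂)).abs.intervalIntegrable _ _)
            (Continuous.intervalIntegrable (by fun_prop) _ _) fun σ hσ =>
              (hpd σ).trans ((mul_le_mul_of_nonneg_left (hN σ hσ.1) hK).trans_eq
                (mul_assoc _ _ _).symm)
        _ = (K * (2 * D / c)) * ∫ σ in (0 : ℝ)..τ, w σ := intervalIntegral.integral_const_mul _ _
        _ ≤ (K * (2 * D / c)) * (w τ / c) := by
          gcongr
          exact hwi τ hτ
        _ = (4 * K) / (c * c) * (D / 2 * w τ) := by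
          field_simp
          ring
        _ ≤ 1 * (D / 2 * w τ) := by
          have := hwp τ
          gcongr
          rw [div_le_one (by positivity)]
          nlinarith
        _ = _ := one_mul _

/-- The delay equation `T' = q (∫ g over [τ - 1, τ])`, where `g` is `φ` on the negative half-line
and `B ∘ T` on the positive one, has a global solution. -/
theorem exists_delay_solution {q φ B : ℝ → ℝ} {r : ℝ} {K : NNReal}
    (hq : LipschitzWith K q) (hq0 : ∀ x, 0 < q x) (hqr : ∀ x, q x ≤ r) (hφ : Continuous φ)
    (hB : ContDiff ℝ 1 B) (h0 : φ 0 = B 0) :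
    ∃ T : ℝ → ℝ, T 0 = 0 ∧ Continuous (fun y => if y ≤ 0 then φ y else B (T y)) ∧
      ∀ τ, HasDerivAt T (q (∫ y in (τ - 1)..τ, if y ≤ 0 then φ y else B (T y))) τ := by
  obtain ⟨T, hT, hfix⟩ := exists_delayOperator_fixedPoint hq
    (fun x => by rw [abs_of_pos (hq0 x)]; exact hqr x) hφ hB h0
  have hprof := continuous_delayProfile hφ hB.continuous h0 r hT
  have hpace : Continuous fun σ : ℝ => q (∫ y in (σ - 1)..σ, delayProfile φ B r T y) :=
    hq.continuous.comp (continuous_window_integral hprof)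
  have hTd : ∀ τ, HasDerivAt T (q (∫ y in (τ - 1)..τ, delayProfile φ B r T y)) τ := by
    intro τ
    have := (hpace.integral_hasStrictDerivAt 0 τ).hasDerivAt
    rwa [show (fun u => ∫ σ in (0 : ℝ)..u, q (∫ y in (σ - 1)..σ, delayProfile φ B r T y)) = T from
      hfix] at this
  have hTeq : ∀ y, T y = ∫ σ in (0 : ℝ)..y, q (∫ y in (σ - 1)..σ, delayProfile φ B r T y) :=
    fun y => (congrFun hfix y).symm
  have hT0 : T 0 = 0 := by rw [hTeq]; simp
  -- The fixed point satisfies `0 ≤ T y ≤ r * y` for `y ≥ 0`, so the truncation can be dropped.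
  have heq : delayProfile φ B r T = fun y => if y ≤ 0 then φ y else B (T y) := by
    funext y
    unfold delayProfile
    split_ifs with hy
    · rfl
    · have hy' : 0 ≤ y := (not_le.1 hy).le
      have h1 : 0 ≤ T y := by
        rw [hTeq]
        exact intervalIntegral.integral_nonneg hy' fun σ _ => (hq0 _).le
      have h2 : T y ≤ r * y := by
        rw [hTeq]
        calc _ ≤ ∫ σ in (0 : ℝ)..y, r := intervalIntegral.integral_mono_on hy'
              (hpace.intervalIntegrable _ _) (by simp) fun σ _ => hqr _
          _ = r * y := by simp [mul_comm]
      rw [min_eq_left h2, max_eq_left h1]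
  rw [heq] at hTd hprof
  exact ⟨T, hT0, hprof, hTd⟩

/-! ### Characteristic flow and existence -/

theorem interval_integral_mem_Icc {g : ℝ → ℝ} {m M τ : ℝ} (hg : Continuous g)
    (h : ∀ y ∈ Set.Icc (τ - 1) τ, g y ∈ Set.Icc m M) :
    ∫ y in (τ - 1)..τ, g y ∈ Set.Icc m M := by
  have hi : ∀ f : ℝ → ℝ, Continuous f → IntervalIntegrable f MeasureTheory.volume (τ - 1) τ :=
    fun f hf => hf.intervalIntegrable _ _
  constructor
  · simpa using intervalIntegral.integral_mono_on (by linarith) (hi _ continuous_const) (hi g hg)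
      (fun y hy => (h y hy).1)
  · simpa using intervalIntegral.integral_mono_on (by linarith) (hi g hg) (hi _ continuous_const)
      (fun y hy => (h y hy).2)

/-- A truncated reciprocal of a positive `C¹` speed is bounded and Lipschitz. -/
theorem exists_truncated_pace {lam : ℝ → ℝ} {m M : ℝ} (hm : 0 < m) (hmM : m ≤ M)
    (hlam : ContDiffOn ℝ 1 lam (Set.Ioi 0)) (hlam_pos : ∀ s ∈ Set.Ioi (0 : ℝ), 0 < lam s) :
    ∃ (q : ℝ → ℝ) (K : NNReal) (δ : ℝ), LipschitzWith K q ∧ 0 < δ ∧ (∀ x, δ ≤ q x) ∧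
      (∀ x, q x ≤ 1 / sInf (lam '' Set.Icc m M)) ∧ ∀ x ∈ Set.Icc m M, q x = (lam x)⁻¹ := by
  have hsub : Set.Icc m M ⊆ Set.Ioi 0 := fun x hx => hm.trans_le hx.1
  have hpos : ∀ x ∈ Set.Icc m M, 0 < lam x := fun x hx => hlam_pos x (hsub hx)
  have hC : ContDiffOn ℝ 1 lam (Set.Icc m M) := hlam.mono hsub
  have hne : (Set.Icc m M).Nonempty := Set.nonempty_Icc.2 hmM
  obtain ⟨K, hK⟩ := (hC.inv fun x hx => (hpos x hx).ne').exists_lipschitzOnWith one_ne_zero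
    (convex_Icc m M) isCompact_Icc
  obtain ⟨x₁, hx₁, hmax⟩ := isCompact_Icc.exists_isMaxOn hne hC.continuousOn
  obtain ⟨x₀, hx₀, hmin⟩ := isCompact_Icc.exists_isMinOn hne hC.continuousOn
  have hcl : ∀ x, max (min x M) m ∈ Set.Icc m M := fun x =>
    ⟨le_max_right _ _, max_le (min_le_right _ _) hmM⟩
  refine ⟨fun x => (lam (max (min x M) m))⁻¹, K, (lam x₁)⁻¹,
    LipschitzWith.of_dist_le_mul fun x y => ?_, inv_pos.2 (hpos _ hx₁), fun x => ?_, fun x => ?_,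
    fun x hx => ?_⟩
  · refine (hK.dist_le_mul _ (hcl x) _ (hcl y)).trans
      (mul_le_mul_of_nonneg_left ?_ K.2)
    rw [Real.dist_eq, Real.dist_eq]
    refine (abs_max_sub_max_le_abs _ _ _).trans ((abs_min_sub_min_le_max _ _ _ _).trans ?_)
    simp
  · exact inv_anti₀ (hpos _ (hcl x)) (hmax (hcl x))
  · have hI : sInf (lam '' Set.Icc m M) = lam x₀ :=
      IsLeast.csInf_eq ⟨Set.mem_image_of_mem _ hx₀, by rintro _ ⟨y, hy, rfl⟩; exact hmin hy⟩
    rw [hI, one_div]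
    exact inv_anti₀ (hpos _ hx₀) (hmin (hcl x))
  · simp [hx.1, hx.2]

/-- The data of the characteristic form of the model: `Λ` is the distance travelled and
`g (Λ t - x)` the density. -/
theorem exists_characteristic_flow {lam b ρ₀ : ℝ → ℝ} {ρs m M : ℝ} (hm : 0 < m)
    (hlam : ContDiffOn ℝ 1 lam (Set.Ioi 0)) (hlam_pos : ∀ s ∈ Set.Ioi (0 : ℝ), 0 < lam s)
    (hρ₀ : ContDiffOn ℝ 1 ρ₀ (Set.Icc 0 1)) (hb : ContDiffOn ℝ 1 b (Set.Ici 0))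
    (hρ₀m : ∀ x ∈ Set.Icc (0 : ℝ) 1, ρ₀ x ∈ Set.Icc m M)
    (hbm : ∀ t ∈ Set.Ici (0 : ℝ), ρs * Real.exp (b t) ∈ Set.Icc m M)
    (hcompat₀ : ρs * Real.exp (b 0) = ρ₀ 0)
    (hcompat₁ : derivWithin b (Set.Ici 0) 0 =
      -lam (∫ x in (0 : ℝ)..1, ρ₀ x) * (derivWithin ρ₀ (Set.Icc 0 1) 0 / ρ₀ 0)) :
    ∃ Λ g : ℝ → ℝ, ContDiff ℝ 1 Λ ∧ ContDiff ℝ 1 g ∧ Λ 0 = 0 ∧ StrictMono Λ ∧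
      Function.Surjective Λ ∧ (∀ y ∈ Set.Icc (-1 : ℝ) 0, g y = ρ₀ (-y)) ∧
      (∀ t, 0 ≤ t → g (Λ t) = ρs * Real.exp (b t)) ∧ (∀ y, -1 ≤ y → g y ∈ Set.Icc m M) ∧
      (∀ t, 0 ≤ t → HasDerivAt Λ (lam (∫ x in (0 : ℝ)..1, g (Λ t - x))) t) ∧
      ∀ s t, s ≤ t → t - s ≤ 1 / sInf (lam '' Set.Icc m M) * (Λ t - Λ s) := by
  have hmM : m ≤ M := (hρ₀m 0 (by simp)).1.trans (hρ₀m 0 (by simp)).2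
  obtain ⟨q, K, δ, hqL, hδ, hqδ, hqr, hq⟩ := exists_truncated_pace hm hmM hlam hlam_pos
  set r := 1 / sInf (lam '' Set.Icc m M)
  obtain ⟨R, hR, hRe, hRd⟩ := exists_contDiff_extension_Icc zero_lt_one hρ₀
  obtain ⟨β, hβ, hβe, hβd⟩ := exists_contDiff_extension_Ici hb
  set B : ℝ → ℝ := fun t => ρs * Real.exp (β t) with hBdef
  have hB : ContDiff ℝ 1 B := contDiff_const.mul hβ.exp
  have h00 : R (-0) = B 0 := by
    rw [neg_zero, hRe 0 (by simp), hBdef]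
    simp only
    rw [hβe 0 (by simp), hcompat₀]
  obtain ⟨T, hT0, hgc, hTd⟩ := exists_delay_solution (φ := fun y => R (-y)) hqL
    (fun x => hδ.trans_le (hqδ x)) hqr (by fun_prop) hB h00
  set g : ℝ → ℝ := fun y => if y ≤ 0 then R (-y) else B (T y) with hg
  have hTd' : ∀ τ, HasDerivAt T (q (∫ y in (τ - 1)..τ, g y)) τ := hTd
  have hTmono : StrictMono T := strictMono_of_deriv_pos fun τ => by
    rw [(hTd' τ).deriv]
    exact hδ.trans_le (hqδ _)
  have hTcont : Continuous T := continuous_iff_continuousAt.2 fun τ => (hTd' τ).continuousAt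
  have hTC : ContDiff ℝ 1 T := by
    refine contDiff_one_iff_deriv.2 ⟨fun τ => (hTd' τ).differentiableAt, ?_⟩
    rw [show deriv T = _ from funext fun τ => (hTd' τ).deriv]
    exact hqL.continuous.comp (continuous_window_integral hgc)
  -- The lower bound on the slope gives surjectivity of `T`; the upper bound `r`, used next, limits
  -- travel times.
  have hTlow : Monotone fun τ => T τ - δ * τ := by
    have hd : ∀ τ, HasDerivAt (fun τ => T τ - δ * τ) (q (∫ y in (τ - 1)..τ, g y) - δ * 1) τ :=
      fun τ => (hTd' τ).sub ((hasDerivAt_id τ).const_mul δ)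
    refine monotone_of_deriv_nonneg (fun τ => (hd τ).differentiableAt) fun τ => ?_
    rw [(hd τ).deriv]
    linarith [hqδ (∫ y in (τ - 1)..τ, g y)]
  have hTup : Monotone fun τ => r * τ - T τ := by
    have hd : ∀ τ, HasDerivAt (fun τ => r * τ - T τ) (r * 1 - q (∫ y in (τ - 1)..τ, g y)) τ :=
      fun τ => ((hasDerivAt_id τ).const_mul r).sub (hTd' τ)
    refine monotone_of_deriv_nonneg (fun τ => (hd τ).differentiableAt) fun τ => ?_
    rw [(hd τ).deriv]
    linarith [hqr (∫ y in (τ - 1)..τ, g y)]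
  have hTsurj : Function.Surjective T := by
    refine hTcont.surjective (Filter.tendsto_atTop_mono' _ ?_
      (Filter.tendsto_id.const_mul_atTop hδ)) (Filter.tendsto_atBot_mono' _ ?_
      (Filter.tendsto_id.const_mul_atBot hδ))
    · filter_upwards [Filter.eventually_ge_atTop 0] with τ hτ
      have := hTlow hτ
      simp only [hT0, mul_zero, sub_zero] at this
      simp only [id]
      linarith
    · filter_upwards [Filter.eventually_le_atBot 0] with τ hτ
      have := hTlow hτ
      simp only [hT0, mul_zero, sub_zero] at this
      simp only [id]
      linarith
  have hgneg : ∀ y ∈ Set.Icc (-1 : ℝ) 0, g y = ρ₀ (-y) := by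
    intro y hy
    simp only [hg, hy.2, if_true]
    exact hRe _ ⟨by linarith [hy.2], by linarith [hy.1]⟩
  have hgpos : ∀ y, 0 ≤ y → g y = ρs * Real.exp (b (T y)) := by
    intro y hy
    have hTy : 0 ≤ T y := hT0 ▸ hTmono.monotone hy
    rcases eq_or_lt_of_le hy with rfl | hy
    · rw [hgneg 0 (by simp), neg_zero, hT0, hcompat₀]
    · simp only [hg, hy.not_ge, if_false, hBdef]
      rw [hβe _ hTy]
  have hgm : ∀ y, -1 ≤ y → g y ∈ Set.Icc m M := by
    intro y hy
    rcases le_total y 0 with h | h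
    · rw [hgneg y ⟨hy, h⟩]
      exact hρ₀m _ ⟨by linarith, by linarith⟩
    · rw [hgpos y h]
      exact hbm _ (hT0 ▸ hTmono.monotone h : (0 : ℝ) ≤ T y)
  -- For `τ ≥ 0` the window stays in `[-1, ∞)`, where `g` lies in `[m, M]`; hence so does its
  -- integral, and `q` is the true reciprocal speed.
  have hTd'' : ∀ τ, 0 ≤ τ → HasDerivAt T (lam (∫ y in (τ - 1)..τ, g y))⁻¹ τ := by
    intro τ hτ
    rw [← hq _ (interval_integral_mem_Icc hgc fun y hy => hgm y (by linarith [hy.1]))]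
    exact hTd' τ
  -- The one-sided derivatives at `0` are `-ρ₀'(0)` and `ρs * exp (b 0) * b'(0) / lam (W 0)`; they
  -- agree by `hcompat₀` and `hcompat₁`.
  have hgC : ContDiff ℝ 1 g := by
    have hBT : ContDiff ℝ 1 fun y => B (T y) := hB.comp hTC
    refine contDiff_one_ite_le (f₁ := fun y => R (-y)) (by fun_prop) hBT
      (by simp only [hT0]; exact h00) ?_
    have hRd0 : HasDerivAt R (derivWithin ρ₀ (Set.Icc 0 1) 0) (-0) := by
      rw [neg_zero, ← hRd 0 (by simp)]
      exact (hR.differentiable one_ne_zero 0).hasDerivAt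
    have hβd0 : HasDerivAt β (derivWithin b (Set.Ici 0) 0) (T 0) := by
      rw [hT0, ← hβd 0 (by simp)]
      exact (hβ.differentiable one_ne_zero 0).hasDerivAt
    have d1 : HasDerivAt (fun y => R (-y)) (derivWithin ρ₀ (Set.Icc 0 1) 0 * -1) 0 :=
      hRd0.comp 0 (hasDerivAt_neg 0)
    have hW0 : ∫ y in (0 - 1 : ℝ)..0, g y = ∫ x in (0 : ℝ)..1, ρ₀ x := by
      have h1 : ∫ y in (0 - 1 : ℝ)..0, g y = ∫ y in (0 - 1 : ℝ)..0, ρ₀ (-y) :=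
        intervalIntegral.integral_congr fun y hy => by
          rw [Set.uIcc_of_le (by norm_num)] at hy
          exact hgneg y ⟨by linarith [hy.1], hy.2⟩
      rw [h1, intervalIntegral.integral_comp_neg]
      norm_num
    have d2 := ((hβd0.comp 0 (hTd'' 0 le_rfl)).exp).const_mul ρs
    have d2' : HasDerivAt (fun y => B (T y)) _ 0 := d2
    rw [d1.deriv, d2'.deriv, hW0]
    simp only [Function.comp, hT0]
    rw [hβe 0 (by simp), ← mul_assoc, hcompat₀, hcompat₁]
    have hl : lam (∫ x in (0 : ℝ)..1, ρ₀ x) ≠ 0 := by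
      rw [← hW0]
      exact (hlam_pos _ (hm.trans_le (interval_integral_mem_Icc hgc
        fun y hy => hgm y (by linarith [hy.1])).1)).ne'
    have hρ : ρ₀ 0 ≠ 0 := (hm.trans_le (hρ₀m 0 (by simp)).1).ne'
    field_simp
  -- `Λ` is the inverse of `T`, so it inherits `C¹` regularity from the nonvanishing derivative.
  set e : ℝ ≃ₜ ℝ := (hTmono.orderIsoOfSurjective T hTsurj).toHomeomorph
  have hTe : ∀ t, T (e.symm t) = t := fun t => e.apply_symm_apply t
  have heT' : ∀ τ, e.symm (T τ) = τ := fun τ => e.symm_apply_apply τ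
  have hΛ0 : e.symm 0 = 0 := by rw [← hT0, heT', hT0]
  have hΛmono : StrictMono e.symm := fun s t hst => by
    rw [← hTmono.lt_iff_lt, hTe, hTe]
    exact hst
  refine ⟨e.symm, g, e.contDiff_symm_deriv (fun τ => (hδ.trans_le (hqδ _)).ne') hTd' hTC, hgC, hΛ0,
    hΛmono, e.symm.surjective, hgneg, fun t ht => ?_, hgm, fun t ht => ?_, fun s t hst => ?_⟩
  · rw [hgpos _ (hΛ0 ▸ hΛmono.monotone ht), hTe]
  · have hΛt : 0 ≤ e.symm t := hΛ0 ▸ hΛmono.monotone ht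
    have h1 := hTd'' _ hΛt
    rw [intervalIntegral.integral_comp_sub_left, sub_zero]
    have hpos := hlam_pos _ (hm.trans_le (interval_integral_mem_Icc hgc
        fun y hy => hgm y (by linarith [hy.1, hΛt])).1)
    have h2 := HasDerivAt.of_local_left_inverse (f := T) (g := e.symm) (a := t)
      e.symm.continuous.continuousAt h1 (inv_pos.2 hpos).ne' (Filter.Eventually.of_forall hTe)
    rwa [inv_inv] at h2
  · have := hTup (hΛmono.monotone hst)
    simp only [hTe] at this
    linarith

/-- Transporting a profile along its characteristics solves the closed-loop model. -/
theorem isSolution_of_characteristic_flow {lam b ρ₀ Λ g : ℝ → ℝ} {ρs m M : ℝ} (hm : 0 < m)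
    (hΛ : ContDiff ℝ 1 Λ) (hg : ContDiff ℝ 1 g) (hΛ0 : Λ 0 = 0) (hΛm : StrictMono Λ)
    (hg0 : ∀ y ∈ Set.Icc (-1 : ℝ) 0, g y = ρ₀ (-y))
    (hgb : ∀ t, 0 ≤ t → g (Λ t) = ρs * Real.exp (b t)) (hgm : ∀ y, -1 ≤ y → g y ∈ Set.Icc m M)
    (hΛd : ∀ t, 0 ≤ t → HasDerivAt Λ (lam (∫ x in (0 : ℝ)..1, g (Λ t - x))) t) :
    Manufacturing.IsSolution lam ρs b ρ₀ fun t x => g (Λ t - x) where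
  contDiffOn := ContDiff.contDiffOn (hg.comp ((hΛ.comp contDiff_fst).sub contDiff_snd))
  pos t ht x hx := by
    have : 0 ≤ Λ t := hΛ0 ▸ hΛm.monotone ht
    exact hm.trans_le (hgm _ (by linarith [hx.2])).1
  pde t ht x hx := by
    have hgd := (hg.differentiable one_ne_zero (Λ t - x)).hasDerivAt
    have h1 : HasDerivAt (fun s => g (Λ s - x)) _ t := hgd.comp t ((hΛd t ht).sub_const x)
    have h2 : HasDerivAt (fun y => g (Λ t - y)) _ x :=
      hgd.comp x ((hasDerivAt_id x).const_sub (Λ t))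
    rw [h1.hasDerivWithinAt.derivWithin (uniqueDiffOn_Ici 0 t ht),
      h2.hasDerivWithinAt.derivWithin (uniqueDiffOn_Icc zero_lt_one x hx)]
    simp only [Manufacturing.totalLoad]
    ring
  influx t ht := by
    simp only [Manufacturing.feedback, sub_zero, hgb t ht]
    ring
  initial x hx := by
    rw [hΛ0, zero_sub, hg0 _ ⟨by linarith [hx.2], by linarith [hx.1]⟩, neg_neg]

/-! ### Calculus on the half-strip -/

theorem HasDerivAt.sub_sq {f g : ℝ → ℝ} {f' g' x : ℝ} (hf : HasDerivAt f f' x)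
    (hg : HasDerivAt g g' x) :
    HasDerivAt (fun y => (f y - g y) ^ 2) (2 * (f x - g x) * (f' - g')) x :=
  ((hf.fun_sub hg).fun_pow 2).congr_deriv (by simp)

/-- The closed half-strip `[0,∞) × [0,1]`. -/
abbrev halfStrip : Set (ℝ × ℝ) := Set.Ici 0 ×ˢ Set.Icc 0 1

theorem mem_halfStrip {t x : ℝ} (ht : 0 ≤ t) (hx : x ∈ Set.Icc (0 : ℝ) 1) :
    (t, x) ∈ halfStrip := ⟨ht, hx⟩

theorem ContinuousOn.halfStrip_section {f : ℝ × ℝ → ℝ} (hf : ContinuousOn f halfStrip) {t : ℝ}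
    (ht : 0 ≤ t) : ContinuousOn (fun x => f (t, x)) (Set.Icc 0 1) :=
  hf.comp (by fun_prop) fun _ hx => mem_halfStrip ht hx

theorem ContinuousOn.intervalIntegrable_section {f : ℝ × ℝ → ℝ} (hf : ContinuousOn f halfStrip)
    {t : ℝ} (ht : 0 ≤ t) : IntervalIntegrable (fun x => f (t, x)) MeasureTheory.volume 0 1 :=
  ContinuousOn.intervalIntegrable_of_Icc zero_le_one (hf.halfStrip_section ht)

theorem ContinuousOn.exists_bound_halfStrip {f : ℝ × ℝ → ℝ} (hf : ContinuousOn f halfStrip)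
    (t₁ : ℝ) : ∃ C, ∀ t ∈ Set.Icc 0 t₁, ∀ x ∈ Set.Icc (0 : ℝ) 1, |f (t, x)| ≤ C := by
  obtain ⟨C, hC⟩ := (isCompact_Icc (a := (0 : ℝ)) (b := t₁)).prod
    (isCompact_Icc (a := (0 : ℝ)) (b := 1)) |>.exists_bound_of_continuousOn
    (hf.mono (Set.prod_mono (fun t ht => ht.1) subset_rfl))
  exact ⟨C, fun t ht x hx => hC (t, x) ⟨ht, hx⟩⟩

theorem ContDiffOn.exists_partial_derivatives {f : ℝ × ℝ → ℝ} (hf : ContDiffOn ℝ 1 f halfStrip) :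
    ∃ ft fx : ℝ × ℝ → ℝ, ContinuousOn ft halfStrip ∧ ContinuousOn fx halfStrip ∧
      ∀ t, 0 ≤ t → ∀ x ∈ Set.Icc (0 : ℝ) 1,
        HasDerivWithinAt (fun s => f (s, x)) (ft (t, x)) (Set.Ici 0) t ∧
        HasDerivWithinAt (fun y => f (t, y)) (fx (t, x)) (Set.Icc 0 1) x := by
  have hu : UniqueDiffOn ℝ halfStrip := (uniqueDiffOn_Ici 0).prod (uniqueDiffOn_Icc zero_lt_one)
  have hc := hf.continuousOn_fderivWithin hu le_rfl
  refine ⟨fun z => fderivWithin ℝ f halfStrip z (1, 0), fun z => fderivWithin ℝ f halfStrip z (0, 1),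
    hc.clm_apply continuousOn_const, hc.clm_apply continuousOn_const, fun t ht x hx => ?_⟩
  have hd := (hf.differentiableOn one_ne_zero (t, x) (mem_halfStrip ht hx)).hasFDerivWithinAt
  constructor
  · exact hd.comp_hasDerivWithinAt t
      ((hasDerivWithinAt_id t _).prodMk (hasDerivWithinAt_const t _ x))
      fun s hs => mem_halfStrip hs hx
  · exact hd.comp_hasDerivWithinAt x
      ((hasDerivWithinAt_const x _ t).prodMk (hasDerivWithinAt_id x _))
      fun y hy => mem_halfStrip ht hy

theorem ContinuousOn.continuousOn_integral_section {f : ℝ × ℝ → ℝ}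
    (hf : ContinuousOn f halfStrip) :
    ContinuousOn (fun t => ∫ x in (0 : ℝ)..1, f (t, x)) (Set.Ici 0) := by
  -- Clamping both coordinates extends `f` continuously to the plane.
  have hc : Continuous fun z : ℝ × ℝ => f (max 0 z.1, max 0 (min 1 z.2)) :=
    hf.comp_continuous (by fun_prop) fun z =>
      ⟨Set.mem_Ici.2 (le_max_left _ _), le_max_left _ _, max_le zero_le_one (min_le_left _ _)⟩
  have hi : Continuous fun t : ℝ => ∫ x in (0 : ℝ)..1, f (max 0 t, max 0 (min 1 x)) :=
    intervalIntegral.continuous_parametric_intervalIntegral_of_continuous' hc 0 1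
  refine hi.continuousOn.congr fun t ht => intervalIntegral.integral_congr fun x hx => ?_
  rw [Set.uIcc_of_le zero_le_one] at hx
  rw [max_eq_right (Set.mem_Ici.1 ht), min_eq_right hx.2, max_eq_right hx.1]

theorem hasDerivAt_integral_section {f ft : ℝ × ℝ → ℝ} (hf : ContinuousOn f halfStrip)
    (hft : ContinuousOn ft halfStrip)
    (hd : ∀ t, 0 < t → ∀ x ∈ Set.Icc (0 : ℝ) 1, HasDerivAt (fun s => f (s, x)) (ft (t, x)) t)
    {t : ℝ} (ht : 0 < t) :
    HasDerivAt (fun s => ∫ x in (0 : ℝ)..1, f (s, x)) (∫ x in (0 : ℝ)..1, ft (t, x)) t := by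
  obtain ⟨C, hC⟩ := hft.exists_bound_halfStrip (t + 1)
  have hsub : ∀ x, x ∈ Set.uIoc (0 : ℝ) 1 → x ∈ Set.Icc (0 : ℝ) 1 := fun x hx => by
    rw [Set.uIoc_of_le zero_le_one] at hx
    exact Set.Ioc_subset_Icc_self hx
  refine (intervalIntegral.hasDerivAt_integral_of_dominated_loc_of_deriv_le
    (F := fun s x => f (s, x)) (F' := fun s x => ft (s, x)) (bound := fun _ => C)
    (s := Set.Ioo 0 (t + 1)) (Ioo_mem_nhds ht (by linarith)) ?_
    (hf.intervalIntegrable_section ht.le) ?_ ?_ (by simp) ?_).2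
  · filter_upwards [Ioi_mem_nhds ht] with s hs
    exact (hf.intervalIntegrable_section (Set.mem_Ioi.1 hs).le).aestronglyMeasurable_restrict_uIoc
  · exact (hft.intervalIntegrable_section ht.le).aestronglyMeasurable_restrict_uIoc
  · exact Filter.Eventually.of_forall fun x hx s hs => hC s ⟨hs.1.le, hs.2.le⟩ x (hsub x hx)
  · exact Filter.Eventually.of_forall fun x hx s hs => hd s hs.1 x (hsub x hx)

/-- Expand `∫ (f - a)² ≥ 0` with `a` the mean of `f`. -/
theorem sq_integral_le_integral_sq {f : ℝ → ℝ} (hf : ContinuousOn f (Set.Icc 0 1)) :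
    (∫ x in (0 : ℝ)..1, f x) ^ 2 ≤ ∫ x in (0 : ℝ)..1, f x ^ 2 := by
  set a := ∫ x in (0 : ℝ)..1, f x with ha
  have hi := ContinuousOn.intervalIntegrable_of_Icc zero_le_one hf
    (μ := MeasureTheory.volume)
  have hi2 : IntervalIntegrable (fun x => f x ^ 2) MeasureTheory.volume 0 1 :=
    ContinuousOn.intervalIntegrable_of_Icc zero_le_one (hf.pow 2)
  have h0 : 0 ≤ ∫ x in (0 : ℝ)..1, (f x ^ 2 - 2 * a * f x + a ^ 2) :=
    intervalIntegral.integral_nonneg zero_le_one fun x _ => by nlinarith [sq_nonneg (f x - a)]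
  rw [intervalIntegral.integral_add (hi2.sub (hi.const_mul _)) (by simp),
    intervalIntegral.integral_sub hi2 (hi.const_mul _), intervalIntegral.integral_const_mul,
    ← ha] at h0
  simp only [intervalIntegral.integral_const, sub_zero, one_smul] at h0
  nlinarith

/-! ### Uniqueness by an energy estimate -/

namespace Manufacturing

variable {lam b ρ₀ : ℝ → ℝ} {ρs : ℝ} {ρ ρ' : ℝ → ℝ → ℝ}

theorem IsSolution.continuousOn (h : IsSolution lam ρs b ρ₀ ρ) :
    ContinuousOn (fun z : ℝ × ℝ => ρ z.1 z.2) halfStrip := h.contDiffOn.continuousOn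

/-- Since `lam` is controlled only on `(0, ∞)`, the load must stay in a compact subset of it before
`lam` can be treated as Lipschitz. -/
theorem IsSolution.exists_bounds (h : IsSolution lam ρs b ρ₀ ρ) {t₁ : ℝ} (ht₁ : 0 ≤ t₁) :
    ∃ m M, 0 < m ∧ ∀ t ∈ Set.Icc 0 t₁, totalLoad ρ t ∈ Set.Icc m M := by
  have hK : IsCompact (Set.Icc (0 : ℝ) t₁ ×ˢ Set.Icc (0 : ℝ) 1) := isCompact_Icc.prod isCompact_Icc
  have hne : (Set.Icc (0 : ℝ) t₁ ×ˢ Set.Icc (0 : ℝ) 1).Nonempty :=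
    ⟨(0, 0), ⟨le_rfl, ht₁⟩, le_rfl, zero_le_one⟩
  have hc : ContinuousOn (fun z : ℝ × ℝ => ρ z.1 z.2) (Set.Icc (0 : ℝ) t₁ ×ˢ Set.Icc (0 : ℝ) 1) :=
    h.continuousOn.mono (Set.prod_mono (fun t ht => ht.1) subset_rfl)
  obtain ⟨z, hz, hmin⟩ := hK.exists_isMinOn hne hc
  obtain ⟨z', hz', hmax⟩ := hK.exists_isMaxOn hne hc
  refine ⟨ρ z.1 z.2, ρ z'.1 z'.2, h.pos _ hz.1.1 _ hz.2, fun t ht => ⟨?_, ?_⟩⟩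
  · simpa [totalLoad] using intervalIntegral.integral_mono_on zero_le_one (by simp)
      (h.continuousOn.intervalIntegrable_section ht.1)
      (fun x hx => hmin (show (t, x) ∈ _ from ⟨ht, hx⟩))
  · simpa [totalLoad] using intervalIntegral.integral_mono_on zero_le_one
      (h.continuousOn.intervalIntegrable_section ht.1) (by simp)
      (fun x hx => hmax (show (t, x) ∈ _ from ⟨ht, hx⟩))

theorem IsSolution.inflow (h : IsSolution lam ρs b ρ₀ ρ)
    (hlam_pos : ∀ s ∈ Set.Ioi (0 : ℝ), 0 < lam s) {t : ℝ} (ht : 0 ≤ t) :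
    ρ t 0 = ρs * Real.exp (b t) := by
  obtain ⟨m, M, hm, hW⟩ := h.exists_bounds ht
  have hpos := hlam_pos _ (hm.trans_le (hW t ⟨ht, le_rfl⟩).1)
  have := h.influx t ht
  rw [feedback] at this
  exact mul_right_cancel₀ hpos.ne' (by linarith)

/-- Two solutions with the same data coincide, by an `L²` energy estimate. -/
theorem IsSolution.eq (h : IsSolution lam ρs b ρ₀ ρ) (h' : IsSolution lam ρs b ρ₀ ρ')
    (hlam : ContDiffOn ℝ 1 lam (Set.Ioi 0)) (hlam_pos : ∀ s ∈ Set.Ioi (0 : ℝ), 0 < lam s)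
    {t x : ℝ} (ht : 0 ≤ t) (hx : x ∈ Set.Icc (0 : ℝ) 1) : ρ' t x = ρ t x := by
  obtain ⟨ft, fx, hft, hfx, hfd⟩ := ContDiffOn.exists_partial_derivatives h.contDiffOn
  obtain ⟨ft', fx', hft', hfx', hfd'⟩ := ContDiffOn.exists_partial_derivatives h'.contDiffOn
  have hpde : ∀ s, 0 ≤ s → ∀ y ∈ Set.Icc (0 : ℝ) 1,
      ft (s, y) + lam (totalLoad ρ s) * fx (s, y) = 0 := fun s hs y hy => by
    rw [← (hfd s hs y hy).1.derivWithin (uniqueDiffOn_Ici 0 s hs),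
      ← (hfd s hs y hy).2.derivWithin (uniqueDiffOn_Icc zero_lt_one y hy)]
    exact h.pde s hs y hy
  have hpde' : ∀ s, 0 ≤ s → ∀ y ∈ Set.Icc (0 : ℝ) 1,
      ft' (s, y) + lam (totalLoad ρ' s) * fx' (s, y) = 0 := fun s hs y hy => by
    rw [← (hfd' s hs y hy).1.derivWithin (uniqueDiffOn_Ici 0 s hs),
      ← (hfd' s hs y hy).2.derivWithin (uniqueDiffOn_Icc zero_lt_one y hy)]
    exact h'.pde s hs y hy
  obtain ⟨m, M, hm, hW⟩ := h.exists_bounds ht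
  obtain ⟨m', M', hm', hW'⟩ := h'.exists_bounds ht
  obtain ⟨K, hK⟩ := (hlam.mono (fun y hy => (lt_min hm hm').trans_le hy.1 :
    Set.Icc (min m m') (max M M') ⊆ Set.Ioi 0)).exists_lipschitzOnWith one_ne_zero
    (convex_Icc _ _) isCompact_Icc
  obtain ⟨C, hC⟩ := hfx.exists_bound_halfStrip t
  set D : ℝ × ℝ → ℝ := fun z => ρ' z.1 z.2 - ρ z.1 z.2 with hD
  have hDc : ContinuousOn D halfStrip := h'.continuousOn.sub h.continuousOn
  set F : ℝ → ℝ := fun s => ∫ y in (0 : ℝ)..1, D (s, y) ^ 2 with hF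
  have hFc : ContinuousOn F (Set.Ici 0) :=
    ContinuousOn.continuousOn_integral_section (f := fun z => D z ^ 2) (hDc.pow 2)
  have hFd : ∀ s, 0 < s → HasDerivAt F
      (∫ y in (0 : ℝ)..1, 2 * D (s, y) * (ft' (s, y) - ft (s, y))) s := by
    intro s hs
    refine hasDerivAt_integral_section (f := fun z => D z ^ 2)
      (ft := fun z => 2 * D z * (ft' z - ft z)) (hDc.pow 2)
      ((hDc.const_mul 2).mul (hft'.sub hft)) (fun s hs y hy => ?_) hs
    have d1 := (hfd s hs.le y hy).1.hasDerivAt (Ici_mem_nhds hs)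
    have d2 := (hfd' s hs.le y hy).1.hasDerivAt (Ici_mem_nhds hs)
    exact d2.sub_sq d1
  have hD0 : ∀ s, 0 ≤ s → D (s, 0) = 0 := fun s hs => by
    simp only [hD]
    rw [h.inflow hlam_pos hs, h'.inflow hlam_pos hs, sub_self]
  -- Subtracting the equations gives `D_t = -v' * D_x + (v - v') * fx`. The first term integrates to
  -- the outflow `-v' * D (s, 1) ^ 2 ≤ 0`, as `D` vanishes at the inlet. In the second, both `|v -
  -- v'|` and the integral of `D * fx` are bounded by multiples of `∫ |D|`.
  have hFle : ∀ s ∈ Set.Ioo 0 t,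
      ∫ y in (0 : ℝ)..1, 2 * D (s, y) * (ft' (s, y) - ft (s, y)) ≤ 2 * K * C * F s := by
    intro s hs
    set v := lam (totalLoad ρ s)
    set v' := lam (totalLoad ρ' s) with hv'
    have hsI : s ∈ Set.Icc 0 t := ⟨hs.1.le, hs.2.le⟩
    have hC0 : 0 ≤ C := (abs_nonneg _).trans (hC s hsI 0 (by simp))
    have hv'0 : 0 < v' := hlam_pos _ (hm'.trans_le (hW' s hsI).1)
    have hDi := hDc.halfStrip_section hs.1.le
    have hDx : ContinuousOn (fun y => 2 * D (s, y) * (fx' (s, y) - fx (s, y))) (Set.Icc 0 1) :=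
      (hDi.const_mul 2).mul
        ((hfx'.halfStrip_section hs.1.le).sub (hfx.halfStrip_section hs.1.le))
    have hrem : ContinuousOn (fun y => D (s, y) * fx (s, y)) (Set.Icc 0 1) :=
      hDi.mul (hfx.halfStrip_section hs.1.le)
    have hflux : ∫ y in (0 : ℝ)..1, 2 * D (s, y) * (fx' (s, y) - fx (s, y)) = D (s, 1) ^ 2 := by
      rw [intervalIntegral.integral_eq_sub_of_hasDerivAt_of_le zero_le_one
        (f := fun y => D (s, y) ^ 2) (hDi.pow 2) (fun y hy => ?_)
        (ContinuousOn.intervalIntegrable_of_Icc zero_le_one hDx), hD0 s hs.1.le]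
      · ring
      · have hy' := Set.Ioo_subset_Icc_self hy
        have d1 := (hfd s hs.1.le y hy').2.hasDerivAt (Icc_mem_nhds hy.1 hy.2)
        have d2 := (hfd' s hs.1.le y hy').2.hasDerivAt (Icc_mem_nhds hy.1 hy.2)
        exact d2.sub_sq d1
    have hsplit : ∫ y in (0 : ℝ)..1, 2 * D (s, y) * (ft' (s, y) - ft (s, y)) =
        -v' * D (s, 1) ^ 2 + 2 * (v - v') * ∫ y in (0 : ℝ)..1, D (s, y) * fx (s, y) := by
      rw [← hflux, ← intervalIntegral.integral_const_mul, ← intervalIntegral.integral_const_mul,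
        ← intervalIntegral.integral_add
        ((ContinuousOn.intervalIntegrable_of_Icc zero_le_one hDx).const_mul _)
        ((ContinuousOn.intervalIntegrable_of_Icc zero_le_one hrem).const_mul _)]
      refine intervalIntegral.integral_congr fun y hy => ?_
      rw [Set.uIcc_of_le zero_le_one] at hy
      have e1 := hpde s hs.1.le y hy
      have e2 := hpde' s hs.1.le y hy
      rw [show ft (s, y) = -v * fx (s, y) by linarith,
        show ft' (s, y) = -v' * fx' (s, y) by linarith]
      ring
    set A := ∫ y in (0 : ℝ)..1, |D (s, y)| with hA
    have hA0 : 0 ≤ A := intervalIntegral.integral_nonneg zero_le_one fun _ _ => abs_nonneg _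
    have hAi := ContinuousOn.intervalIntegrable_of_Icc (μ := MeasureTheory.volume) zero_le_one
      hDi.abs
    have hv : |v - v'| ≤ K * A := by
      have h1 := hK.dist_le_mul _ ⟨(min_le_left _ _).trans (hW s hsI).1,
        (hW s hsI).2.trans (le_max_left _ _)⟩ _ ⟨(min_le_right _ _).trans (hW' s hsI).1,
        (hW' s hsI).2.trans (le_max_right _ _)⟩
      refine h1.trans (mul_le_mul_of_nonneg_left ?_ K.2)
      rw [dist_comm, Real.dist_eq, totalLoad, totalLoad, ← intervalIntegral.integral_sub
        (h'.continuousOn.intervalIntegrable_section hs.1.le)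
        (h.continuousOn.intervalIntegrable_section hs.1.le)]
      exact intervalIntegral.abs_integral_le_integral_abs zero_le_one
    have hI : |∫ y in (0 : ℝ)..1, D (s, y) * fx (s, y)| ≤ C * A := by
      refine (intervalIntegral.abs_integral_le_integral_abs zero_le_one).trans ?_
      rw [hA, ← intervalIntegral.integral_const_mul]
      refine intervalIntegral.integral_mono_on zero_le_one
        (ContinuousOn.intervalIntegrable_of_Icc zero_le_one hrem.abs) (hAi.const_mul _)
        fun y hy => ?_
      rw [abs_mul, mul_comm]
      exact mul_le_mul_of_nonneg_right (hC s hsI y hy) (abs_nonneg _)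
    have hAF : A ^ 2 ≤ F s := by
      have := sq_integral_le_integral_sq hDi.abs
      simpa only [sq_abs] using this
    have hprod : (v - v') * ∫ y in (0 : ℝ)..1, D (s, y) * fx (s, y) ≤ (K * A) * (C * A) := by
      refine (le_abs_self _).trans ?_
      rw [abs_mul]
      exact mul_le_mul hv hI (abs_nonneg _) (mul_nonneg K.2 hA0)
    have hKC : 0 ≤ (K : ℝ) * C := mul_nonneg K.2 hC0
    rw [hsplit]
    nlinarith [mul_nonneg hv'0.le (sq_nonneg (D (s, 1))), mul_le_mul_of_nonneg_left hAF hKC]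
  -- Grönwall's inequality in integrating-factor form.
  have hanti : AntitoneOn (fun s => F s * Real.exp (-(2 * K * C) * s)) (Set.Icc 0 t) := by
    have hd : ∀ s ∈ Set.Ioo 0 t, HasDerivAt (fun s => F s * Real.exp (-(2 * K * C) * s)) _ s :=
      fun s hs => (hFd s hs.1).mul (((hasDerivAt_id s).const_mul (-(2 * K * C))).exp)
    refine antitoneOn_of_deriv_nonpos (convex_Icc 0 t)
      ((hFc.mono fun s hs => hs.1).mul (by fun_prop)) ?_ ?_
    · rw [interior_Icc]
      exact fun s hs => (hd s hs).differentiableAt.differentiableWithinAt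
    · rw [interior_Icc]
      intro s hs
      rw [(hd s hs).deriv]
      simp only [id]
      have := mul_le_mul_of_nonneg_right (hFle s hs) (Real.exp_pos (-(2 * K * C) * s)).le
      linarith
  have hF0 : F 0 = 0 := by
    rw [hF]
    simp only
    -- The initial condition omits `x = 0`, hence equality almost everywhere.
    rw [intervalIntegral.integral_congr_ae (g := fun _ => 0)]
    · simp
    · refine Filter.Eventually.of_forall fun y hy => ?_
      rw [Set.uIoc_of_le zero_le_one] at hy
      simp [hD, h.initial y hy, h'.initial y hy]
  have hFt : F t ≤ 0 := by
    have := hanti (Set.left_mem_Icc.2 ht) (Set.right_mem_Icc.2 ht) ht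
    simp only [hF0, zero_mul] at this
    exact nonpos_of_mul_nonpos_left this (Real.exp_pos _)
  by_contra hne
  have hpos : 0 < F t := intervalIntegral.integral_pos zero_lt_one
    ((hDc.halfStrip_section ht).pow 2) (fun y _ => sq_nonneg _)
    ⟨x, hx, by
      have : D (t, x) ≠ 0 := sub_ne_zero.2 hne
      positivity⟩
  exact hFt.not_gt hpos

end Manufacturing

/-! ### Norms of a profile that is part inflow, part translated data -/

/-- Split at the front `a`: the inflow part is dominated by the integral of `exp (p * k * x)` over
all of `[0, 1]`, which produces the constant. -/
theorem integral_rpow_shift_le {l l₀ : ℝ → ℝ} {a N k p : ℝ} (ha : a ∈ Set.Icc (0 : ℝ) 1)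
    (hN : 0 ≤ N) (hk : 0 < k) (hp : 1 < p) (hl : ContinuousOn l (Set.Icc 0 1))
    (hl0 : ∀ x, 0 ≤ l x)
    (hle : ∀ x ∈ Set.Icc 0 a, l x ≤ N * Real.exp (k * x))
    (hshift : ∀ x ∈ Set.Ioc a 1, l x = l₀ (x - a)) :
    ∫ x in (0 : ℝ)..1, l x ^ p ≤
      (∫ x in (0 : ℝ)..(1 - a), l₀ x ^ p) + (Real.exp (p * k) - 1) / (p * k) * N ^ p := by
  have hp0 : 0 < p := by linarith
  have hlp : ContinuousOn (fun x => l x ^ p) (Set.Icc 0 1) :=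
    hl.rpow_const fun _ _ => Or.inr hp0.le
  have hi1 : IntervalIntegrable (fun x => l x ^ p) MeasureTheory.volume 0 a :=
    ContinuousOn.intervalIntegrable_of_Icc ha.1 (hlp.mono (Set.Icc_subset_Icc_right ha.2))
  have hi2 : IntervalIntegrable (fun x => l x ^ p) MeasureTheory.volume a 1 :=
    ContinuousOn.intervalIntegrable_of_Icc ha.2 (hlp.mono (Set.Icc_subset_Icc_left ha.1))
  have hexp : ∀ c d : ℝ, IntervalIntegrable (fun x => N ^ p * Real.exp (p * k * x))
      MeasureTheory.volume c d := fun c d => Continuous.intervalIntegrable (by fun_prop) c d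
  have hE : ∫ x in (0 : ℝ)..1, N ^ p * Real.exp (p * k * x) =
      (Real.exp (p * k) - 1) / (p * k) * N ^ p := by
    rw [intervalIntegral.integral_const_mul,
      intervalIntegral.integral_comp_mul_left (fun x => Real.exp x) (by positivity : p * k ≠ 0),
      integral_exp, mul_zero, mul_one, Real.exp_zero, smul_eq_mul]
    ring
  have h1 : ∫ x in (0 : ℝ)..a, l x ^ p ≤ (Real.exp (p * k) - 1) / (p * k) * N ^ p := by
    rw [← hE]
    calc _ ≤ ∫ x in (0 : ℝ)..a, N ^ p * Real.exp (p * k * x) := by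
          refine intervalIntegral.integral_mono_on ha.1 hi1 (hexp _ _) fun x hx => ?_
          calc l x ^ p ≤ (N * Real.exp (k * x)) ^ p :=
                Real.rpow_le_rpow (hl0 x) (hle x hx) hp0.le
            _ = _ := by
              rw [Real.mul_rpow hN (Real.exp_pos _).le, ← Real.exp_mul]
              ring_nf
      _ ≤ _ := intervalIntegral.integral_mono_interval le_rfl ha.1 ha.2
          (Filter.Eventually.of_forall fun x => by positivity) (hexp _ _)
  have h2 : ∫ x in a..1, l x ^ p = ∫ x in (0 : ℝ)..(1 - a), l₀ x ^ p := by
    rw [show (0 : ℝ) = a - a by ring,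
      ← intervalIntegral.integral_comp_sub_right (fun x => l₀ x ^ p)]
    refine intervalIntegral.integral_congr_ae (Filter.Eventually.of_forall fun x hx => ?_)
    rw [Set.uIoc_of_le ha.2] at hx
    rw [hshift x hx]
  rw [← intervalIntegral.integral_add_adjacent_intervals hi1 hi2, h2]
  linarith

/-- Subadditivity of `s ↦ s ^ (1 / p)` separates the two parts. The factor `η` stands for `h (t -
r)`: when it is `0`, the front has reached `a = 1` and no initial data remain. -/
theorem rpow_integral_shift_le {l l₀ : ℝ → ℝ} {a N k p η : ℝ} (ha : a ∈ Set.Icc (0 : ℝ) 1)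
    (hN : 0 ≤ N) (hk : 0 < k) (hp : 1 < p) (hl : ContinuousOn l (Set.Icc 0 1))
    (hl₀ : ContinuousOn l₀ (Set.Icc 0 1)) (hl0 : ∀ x, 0 ≤ l x) (hl₀0 : ∀ x, 0 ≤ l₀ x)
    (hle : ∀ x ∈ Set.Icc 0 a, l x ≤ N * Real.exp (k * x))
    (hshift : ∀ x ∈ Set.Ioc a 1, l x = l₀ (x - a)) (hη : η = 1 ∨ η = 0 ∧ a = 1) :
    (∫ x in (0 : ℝ)..1, l x ^ p) ^ (1 / p) ≤
      η * (∫ x in (0 : ℝ)..1, l₀ x ^ p) ^ (1 / p) +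
        ((Real.exp (p * k) - 1) / (p * k)) ^ (1 / p) * N := by
  have hp0 : 0 < p := by linarith
  have hpi : 0 < 1 / p := by positivity
  have key := integral_rpow_shift_le ha hN hk hp hl hl0 hle hshift
  set E := (Real.exp (p * k) - 1) / (p * k) with hEdef
  have hE : 0 ≤ E := div_nonneg (sub_nonneg.2 (Real.one_le_exp (by positivity))) (by positivity)
  have hI : 0 ≤ ∫ x in (0 : ℝ)..(1 - a), l₀ x ^ p :=
    intervalIntegral.integral_nonneg (by linarith [ha.2]) fun x _ => Real.rpow_nonneg (hl₀0 x) p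
  have hNE : (E * N ^ p) ^ (1 / p) = E ^ (1 / p) * N := by
    rw [Real.mul_rpow hE (Real.rpow_nonneg hN p), ← Real.rpow_mul hN,
      mul_one_div_cancel hp0.ne', Real.rpow_one]
  have hl₀p : ContinuousOn (fun x => l₀ x ^ p) (Set.Icc 0 1) :=
    hl₀.rpow_const fun _ _ => Or.inr hp0.le
  calc _ ≤ ((∫ x in (0 : ℝ)..(1 - a), l₀ x ^ p) + E * N ^ p) ^ (1 / p) :=
        Real.rpow_le_rpow (intervalIntegral.integral_nonneg zero_le_one fun x _ =>
          Real.rpow_nonneg (hl0 x) p) key hpi.le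
    _ ≤ (∫ x in (0 : ℝ)..(1 - a), l₀ x ^ p) ^ (1 / p) + (E * N ^ p) ^ (1 / p) :=
        Real.rpow_add_le_add_rpow hI (by positivity) hpi.le ((div_le_one hp0).2 hp.le)
    _ ≤ _ := by
      rw [hNE]
      refine add_le_add_left ?_ _
      rcases hη with rfl | ⟨rfl, rfl⟩
      · rw [one_mul]
        refine Real.rpow_le_rpow hI (intervalIntegral.integral_mono_interval le_rfl
          (by linarith [ha.2]) (by linarith [ha.1]) ?_
          (ContinuousOn.intervalIntegrable_of_Icc zero_le_one hl₀p)) hpi.le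
        exact Filter.Eventually.of_forall fun x => Real.rpow_nonneg (hl₀0 x) p
      · rw [sub_self, intervalIntegral.integral_same, Real.zero_rpow hpi.ne', zero_mul]

theorem sSup_shift_le {l l₀ : ℝ → ℝ} {a N k η : ℝ} (ha : a ∈ Set.Icc (0 : ℝ) 1)
    (hN : 0 ≤ N) (hk : 0 < k) (hl₀ : ContinuousOn l₀ (Set.Icc 0 1)) (hl₀0 : ∀ x, 0 ≤ l₀ x)
    (hle : ∀ x ∈ Set.Icc 0 a, l x ≤ N * Real.exp (k * x))
    (hshift : ∀ x ∈ Set.Ioc a 1, l x = l₀ (x - a)) (hη : η = 1 ∨ η = 0 ∧ a = 1) :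
    sSup (l '' Set.Icc 0 1) ≤ η * sSup (l₀ '' Set.Icc 0 1) + Real.exp k * N := by
  have hb : ∀ x ∈ Set.Icc (0 : ℝ) 1, l₀ x ≤ sSup (l₀ '' Set.Icc 0 1) := fun x hx =>
    le_csSup (isCompact_Icc.bddAbove_image hl₀) (Set.mem_image_of_mem _ hx)
  have hS : 0 ≤ sSup (l₀ '' Set.Icc 0 1) := (hl₀0 0).trans (hb 0 (by simp))
  refine csSup_le ((Set.nonempty_Icc.2 zero_le_one).image l) ?_
  rintro _ ⟨x, hx, rfl⟩
  have hEN : 0 ≤ Real.exp k * N := by positivity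
  rcases le_or_gt x a with h | h
  · have h1 : N * Real.exp (k * x) ≤ N * Real.exp k :=
      mul_le_mul_of_nonneg_left (Real.exp_le_exp.2 (by nlinarith [hx.2])) hN
    have h2 : 0 ≤ η * sSup (l₀ '' Set.Icc 0 1) := by
      rcases hη with rfl | ⟨rfl, -⟩
      · rwa [one_mul]
      · rw [zero_mul]
    linarith [hle x ⟨hx.1, h⟩]
  · rcases hη with rfl | ⟨-, rfl⟩
    · rw [hshift x ⟨h, hx.2⟩, one_mul]
      have := hb (x - a) ⟨by linarith, by linarith [hx.2, ha.1]⟩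
      linarith
    · exact absurd hx.2 h.not_ge

/-! ### Fading-memory estimates -/

namespace Manufacturing

theorem abs_mul_exp_le_memoryMax {b : ℝ → ℝ} (hb : ∃ M : ℝ, ∀ t ∈ Set.Ici (0 : ℝ), |b t| ≤ M)
    {μ r s t : ℝ} (hμ : 0 < μ) (hs : s ∈ Set.Icc (max 0 (t - r)) t) :
    |b s| * Real.exp (-μ * (t - s)) ≤ memoryMax b μ r t := by
  obtain ⟨M, hM⟩ := hb
  refine le_csSup ⟨M, ?_⟩ (Set.mem_image_of_mem _ hs)
  rintro _ ⟨u, hu, rfl⟩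
  have h1 : Real.exp (-μ * (t - u)) ≤ 1 := Real.exp_le_one_iff.2 (by nlinarith [hu.2])
  exact (mul_le_of_le_one_right (abs_nonneg _) h1).trans (hM u ((le_max_left _ _).trans hu.1))

/-- The fading-memory estimates for a density transported along characteristics. -/
theorem characteristic_flow_estimates {b ρ₀ Λ g : ℝ → ℝ} {ρs m M r t μ : ℝ} (hm : 0 < m)
    (hρs : 0 < ρs) (hb : ∃ M : ℝ, ∀ t ∈ Set.Ici (0 : ℝ), |b t| ≤ M)
    (hρ₀ : ContinuousOn ρ₀ (Set.Icc 0 1)) (hρ₀_pos : ∀ x ∈ Set.Icc (0 : ℝ) 1, 0 < ρ₀ x)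
    (hg : Continuous g) (hΛ0 : Λ 0 = 0) (hΛm : StrictMono Λ) (hΛs : Function.Surjective Λ)
    (hg0 : ∀ y ∈ Set.Icc (-1 : ℝ) 0, g y = ρ₀ (-y))
    (hgb : ∀ t, 0 ≤ t → g (Λ t) = ρs * Real.exp (b t)) (hgm : ∀ y, -1 ≤ y → g y ∈ Set.Icc m M)
    (hr : ∀ s t, s ≤ t → t - s ≤ r * (Λ t - Λ s)) (ht : 0 ≤ t) (hμ : 0 < μ) :
    (∀ p : ℝ, 1 < p → logNorm p ρs (fun x => g (Λ t - x)) ≤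
      h (t - r) * logNorm p ρs ρ₀ + ((Real.exp (p * μ * r) - 1) / (p * μ * r)) ^ (1 / p)
        * memoryMax b μ r t) ∧
    logSupNorm ρs (fun x => g (Λ t - x)) ≤
      h (t - r) * logSupNorm ρs ρ₀ + Real.exp (μ * r) * memoryMax b μ r t := by
  have hr0 : 0 < r := by
    have h1 := hr 0 1 zero_le_one
    have h2 := hΛm zero_lt_one
    rw [hΛ0] at h1 h2
    by_contra hneg
    nlinarith
  have hΛt : 0 ≤ Λ t := hΛ0 ▸ hΛm.monotone ht
  have htr : t ≤ r * Λ t := by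
    have := hr 0 t ht
    rwa [hΛ0, sub_zero, sub_zero] at this
  set N := memoryMax b μ r t
  have hN : 0 ≤ N := by
    have := abs_mul_exp_le_memoryMax hb hμ
      (Set.right_mem_Icc.2 (max_le ht (by linarith)) : t ∈ Set.Icc (max 0 (t - r)) t)
    exact (by positivity : 0 ≤ |b t| * Real.exp (-μ * (t - t))).trans this
  have ha : min (Λ t) 1 ∈ Set.Icc (0 : ℝ) 1 := ⟨le_min hΛt zero_le_one, min_le_right _ _⟩
  have hl : ContinuousOn (fun x => |Real.log (g (Λ t - x) / ρs)|) (Set.Icc 0 1) := by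
    refine ContinuousOn.abs (ContinuousOn.log (by fun_prop) fun x hx => ?_)
    exact (div_pos (hm.trans_le (hgm _ (by linarith [hx.2])).1) hρs).ne'
  have hl₀ : ContinuousOn (fun x => |Real.log (ρ₀ x / ρs)|) (Set.Icc 0 1) :=
    ContinuousOn.abs (ContinuousOn.log (hρ₀.div_const ρs) fun x hx =>
      (div_pos (hρ₀_pos x hx) hρs).ne')
  have hle : ∀ x ∈ Set.Icc 0 (min (Λ t) 1),
      |Real.log (g (Λ t - x) / ρs)| ≤ N * Real.exp (μ * r * x) := by
    intro x hx
    -- `s` is the time at which the material now at `x` entered the line.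
    obtain ⟨s, hs⟩ := hΛs (Λ t - x)
    have hxΛ := hx.2.trans (min_le_left _ _)
    have hx1 := hx.2.trans (min_le_right _ _)
    have hs0 : 0 ≤ s := by
      rw [← hΛm.le_iff_le, hΛ0, hs]
      linarith
    have hst : s ≤ t := by
      rw [← hΛm.le_iff_le, hs]
      linarith [hx.1]
    have hts : t - s ≤ r * x := by
      have := hr s t hst
      rwa [hs, sub_sub_cancel] at this
    have hmem : s ∈ Set.Icc (max 0 (t - r)) t := ⟨max_le hs0 (by nlinarith), hst⟩
    rw [← hs, hgb s hs0, mul_div_cancel_left₀ _ hρs.ne', Real.log_exp]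
    calc |b s| = |b s| * Real.exp (-μ * (t - s)) * Real.exp (μ * (t - s)) := by
          rw [mul_assoc, ← Real.exp_add, neg_mul, neg_add_cancel, Real.exp_zero, mul_one]
      _ ≤ N * Real.exp (μ * r * x) := by
          refine mul_le_mul (abs_mul_exp_le_memoryMax hb hμ hmem) (Real.exp_le_exp.2 ?_)
            (Real.exp_pos _).le hN
          rw [mul_assoc]
          exact mul_le_mul_of_nonneg_left hts hμ.le
  have hshift : ∀ x ∈ Set.Ioc (min (Λ t) 1) 1,
      |Real.log (g (Λ t - x) / ρs)| = |Real.log (ρ₀ (x - min (Λ t) 1) / ρs)| := by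
    intro x hx
    have hlt : Λ t < x := (min_lt_iff.1 hx.1).resolve_right hx.2.not_gt
    rw [min_eq_left (hlt.le.trans hx.2), hg0 _ ⟨by linarith [hx.2], by linarith⟩, neg_sub]
  -- If `t ≥ r`, then `t ≤ r * Λ t` forces `Λ t ≥ 1`: the line has been flushed.
  have hη : h (t - r) = 1 ∨ h (t - r) = 0 ∧ min (Λ t) 1 = 1 := by
    by_cases hc : t - r < 0
    · exact Or.inl (if_pos hc)
    · refine Or.inr ⟨if_neg hc, min_eq_right ?_⟩
      by_contra hneg
      nlinarith
  refine ⟨fun p hp => ?_, ?_⟩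
  · rw [mul_assoc p]
    exact rpow_integral_shift_le ha hN (by positivity) hp hl hl₀ (fun _ => abs_nonneg _)
      (fun _ => abs_nonneg _) hle hshift hη
  · exact sSup_shift_le ha hN (by positivity) hl₀ (fun _ => abs_nonneg _) hle hshift hη

end Manufacturing

/-! ### Bounds on the data and conclusion -/

namespace Manufacturing

theorem densityMin_pos {ρs : ℝ} {b ρ₀ : ℝ → ℝ} (hρs : 0 < ρs)
    (hρ₀ : ContinuousOn ρ₀ (Set.Icc 0 1)) (hρ₀_pos : ∀ x ∈ Set.Icc (0 : ℝ) 1, 0 < ρ₀ x) :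
    0 < densityMin ρs b ρ₀ := by
  refine lt_min ?_ (by positivity)
  obtain ⟨x, hx, hxe⟩ := (isCompact_Icc.image_of_continuousOn hρ₀).sInf_mem
    ((Set.nonempty_Icc.2 zero_le_one).image ρ₀)
  rw [← hxe]
  exact hρ₀_pos x hx

theorem initial_mem_density_bounds {ρs : ℝ} {b ρ₀ : ℝ → ℝ} (hρ₀ : ContinuousOn ρ₀ (Set.Icc 0 1)) :
    ∀ x ∈ Set.Icc (0 : ℝ) 1, ρ₀ x ∈ Set.Icc (densityMin ρs b ρ₀) (densityMax ρs b ρ₀) :=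
  fun _ hx => ⟨(min_le_left _ _).trans
      (csInf_le (isCompact_Icc.bddBelow_image hρ₀) (Set.mem_image_of_mem _ hx)),
    (le_csSup (isCompact_Icc.bddAbove_image hρ₀) (Set.mem_image_of_mem _ hx)).trans
      (le_max_left _ _)⟩

theorem inflow_mem_density_bounds {ρs : ℝ} {b ρ₀ : ℝ → ℝ} (hρs : 0 < ρs)
    (hb : ∃ M : ℝ, ∀ t ∈ Set.Ici (0 : ℝ), |b t| ≤ M) :
    ∀ t ∈ Set.Ici (0 : ℝ),
      ρs * Real.exp (b t) ∈ Set.Icc (densityMin ρs b ρ₀) (densityMax ρs b ρ₀) := by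
  obtain ⟨C, hC⟩ := hb
  have hlow : BddBelow (b '' Set.Ici 0) :=
    ⟨-C, by rintro _ ⟨s, hs, rfl⟩; exact (abs_le.1 (hC s hs)).1⟩
  have hupp : BddAbove (b '' Set.Ici 0) :=
    ⟨C, by rintro _ ⟨s, hs, rfl⟩; exact (abs_le.1 (hC s hs)).2⟩
  refine fun t ht => ⟨(min_le_right _ _).trans ?_, le_trans ?_ (le_max_right _ _)⟩
  · exact mul_le_mul_of_nonneg_left
      (Real.exp_le_exp.2 (csInf_le hlow (Set.mem_image_of_mem _ ht))) hρs.le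
  · exact mul_le_mul_of_nonneg_left
      (Real.exp_le_exp.2 (le_csSup hupp (Set.mem_image_of_mem _ ht))) hρs.le

end Manufacturing

theorem theorem3p1
    (lam : ℝ → ℝ) (ρs : ℝ) (b ρ₀ : ℝ → ℝ)
    (hlam : ContDiffOn ℝ 1 lam (Set.Ioi 0))
    (hlam_pos : ∀ s ∈ Set.Ioi (0 : ℝ), 0 < lam s)
    (hρs : 0 < ρs)
    (hρ₀ : ContDiffOn ℝ 1 ρ₀ (Set.Icc 0 1))
    (hρ₀_pos : ∀ x ∈ Set.Icc (0 : ℝ) 1, 0 < ρ₀ x)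
    (hb : ContDiffOn ℝ 1 b (Set.Ici 0))
    (hb_bdd : ∃ M : ℝ, ∀ t ∈ Set.Ici (0 : ℝ), |b t| ≤ M)
    (hcompat₀ : ρs * Real.exp (b 0) = ρ₀ 0)
    (hcompat₁ : derivWithin b (Set.Ici 0) 0 =
      -lam (∫ x in (0 : ℝ)..1, ρ₀ x) * (derivWithin ρ₀ (Set.Icc 0 1) 0 / ρ₀ 0)) :
    ∃ ρ : ℝ → ℝ → ℝ,
      Manufacturing.IsSolution lam ρs b ρ₀ ρ ∧
      (∀ ρ' : ℝ → ℝ → ℝ, Manufacturing.IsSolution lam ρs b ρ₀ ρ' →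
        ∀ t ∈ Set.Ici (0 : ℝ), ∀ x ∈ Set.Icc (0 : ℝ) 1, ρ' t x = ρ t x) ∧
      ∀ r : ℝ, r = Manufacturing.terminalTime lam ρs b ρ₀ →
        ∀ t : ℝ, 0 ≤ t → ∀ μ : ℝ, 0 < μ →
          (∀ p : ℝ, 1 < p →
            Manufacturing.logNorm p ρs (ρ t) ≤
              Manufacturing.h (t - r) * Manufacturing.logNorm p ρs ρ₀
              + ((Real.exp (p * μ * r) - 1) / (p * μ * r)) ^ (1 / p)
                * Manufacturing.memoryMax b μ r t) ∧
          Manufacturing.logSupNorm ρs (ρ t) ≤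
            Manufacturing.h (t - r) * Manufacturing.logSupNorm ρs ρ₀
            + Real.exp (μ * r) * Manufacturing.memoryMax b μ r t := by
  have hm := Manufacturing.densityMin_pos (b := b) hρs hρ₀.continuousOn hρ₀_pos
  obtain ⟨Λ, g, hΛ, hg, hΛ0, hΛm, hΛs, hg0, hgb, hgm, hΛd, hr⟩ :=
    exists_characteristic_flow hm hlam hlam_pos hρ₀ hb
      (Manufacturing.initial_mem_density_bounds hρ₀.continuousOn)
      (Manufacturing.inflow_mem_density_bounds hρs hb_bdd) hcompat₀ hcompat₁
  have hsol := isSolution_of_characteristic_flow hm hΛ hg hΛ0 hΛm hg0 hgb hgm hΛd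
  refine ⟨fun t x => g (Λ t - x), hsol,
    fun ρ' hsol' t ht x hx => hsol.eq hsol' hlam hlam_pos ht hx, ?_⟩
  rintro r rfl t ht μ hμ
  exact Manufacturing.characteristic_flow_estimates hm hρs hb_bdd hρ₀.continuousOn hρ₀_pos
    hg.continuous hΛ0 hΛm hΛs hg0 hgb hgm hr ht hμ
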